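/- **Proposition (Height bound).** Let $m,n\ge 1$ be integers, write $\mathbb{R}^{m+n}=\mathbb{R}^m\times\mathbb{R}^n\ni z=(x,y)$ and let $\mathbf{C}_r=\{(x,y): |x|<r\}$. There are constants $C\ge 0$ and $\delta_0>0$, depending only on $m$ and $n$, with the following property. Assume that: (i) $M\subset\mathbb{R}^{m+n}$ is a smooth ($C^\infty$) embedded $m$-dimensional submanifold which is $\delta$-flat in $\mathbf{C}_2$ for some $\delta\le\delta_0$, that is, $M\cap\mathbf{C}_2$ is the graph of a map $g\in C^2(B_2,\mathbb{R}^n)$, where $B_2=\{x\in\mathbb{R}^m:|x|<2\}$, with $$\sup_{x\in B_2}\Big(\tfrac12|g(x)|+|Dg(x)|+2|D^2g(x)|\Big)\le\delta ;$$ (ii) $V$ is an integer rectifiable $m$-dimensional varifold in $\mathbf{C}_1$: its weight is a Radon measure $\|V\|=\Theta\,\mathcal{H}^m\llcorner E$ on $\mathbf{C}_1$, where $E\subset\mathbf{C}_1$ is an $m$-rectifiable Borel set and $\Theta$ is a Borel function with positive integer values $\mathcal{H}^m$-a.e. on $E$, and $T_zV$ denotes the approximate tangent plane of $E$ at $\|V\|$-a.e.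 $z$. Moreover $V$ is stationary in $\mathbf{C}_1$, i.e. $\int \mathrm{div}_{T_zV}X(z)\,d\|V\|(z)=0$ for every $X\in C_c^\infty(\mathbf{C}_1,\mathbb{R}^{m+n})$, and its support in $\mathbf{C}_1$ satisfies $\mathrm{supp}(V)\subset\{(x,y):|x|<1,\ |y|<1\}$. Then, denoting by $d_M$ the distance function from $M$ and by $H_M$ the mean curvature vector of $M$, $$\sup_{\mathrm{supp}(V)\cap\mathbf{C}_{1/2}}d_M^2\ \le\ C\Big(\int_{\mathbf{C}_1}d_M^2\,d\|V\|+\|V\|(\mathbf{C}_1)\,\sup_{M\cap\mathbf{C}_1}|H_M|^2\Big),$$ where both sides take values in $[0,\infty]$, with the conventions $0\cdot\infty=0$ and $\sup\emptyset=0$. -/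

import Mathlib

open MeasureTheory Filter Topology Set
open scoped ENNReal NNReal ContDiff

noncomputable section

namespace HeightBound

/-! ### The ambient space and cylinders -/

/-- The Euclidean space `ℝ^{m+n} = ℝ^m × ℝ^n`; the reference plane `π₀` is `ℝ^m × {0}`. -/
abbrev Space (m n : ℕ) : Type :=
  WithLp 2 (EuclideanSpace ℝ (Fin m) × EuclideanSpace ℝ (Fin n))

/-- The open cylinder `C_r = B_r(0, π₀) + π₀^⊥`. -/
def cyl (m n : ℕ) (r : ℝ) : Set (Space m n) := {z | ‖z.fst‖ < r}

/-! ### Submanifolds, second fundamental form, mean curvature -/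

/-- `M` is an embedded `m`-dimensional `C^∞` submanifold of `ℝ^{m+n}` (not necessarily closed):
near each of its points a `C^∞` diffeomorphism between open sets straightens it to
`ℝ^m × {0}`. -/
def IsSmoothSubmanifold {m n : ℕ} (M : Set (Space m n)) : Prop :=
  ∀ p ∈ M, ∃ Φ : OpenPartialHomeomorph (Space m n) (Space m n),
    p ∈ Φ.source ∧ ContDiffOn ℝ ∞ Φ Φ.source ∧ ContDiffOn ℝ ∞ Φ.symm Φ.target ∧
      ∀ z ∈ Φ.source, z ∈ M ↔ (Φ z).snd = 0

/-- `δ`-flatness in `C_r`: `M ∩ C_r` is the graph of some `g ∈ C²(B_r, ℝ^n)` with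
`r⁻¹ |g| + |Dg| + r |D²g| ≤ δ` on `B_r`. -/
def IsFlat {m n : ℕ} (M : Set (Space m n)) (r δ : ℝ) : Prop :=
  ∃ g : EuclideanSpace ℝ (Fin m) → EuclideanSpace ℝ (Fin n),
    ContDiffOn ℝ 2 g (Metric.ball 0 r) ∧
    M ∩ cyl m n r = {z | z.fst ∈ Metric.ball 0 r ∧ z.snd = g z.fst} ∧
    ∀ x ∈ Metric.ball (0 : EuclideanSpace ℝ (Fin m)) r,
      r⁻¹ * ‖g x‖ + ‖fderiv ℝ g x‖ + r * ‖fderiv ℝ (fderiv ℝ g) x‖ ≤ δ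

section Curvature

variable {E : Type*} [NormedAddCommGroup E] [InnerProductSpace ℝ E] [FiniteDimensional ℝ E]

/-- The tangent space `T_p M`. -/
def tangentPlane (M : Set E) (p : E) : Submodule ℝ E :=
  Submodule.span ℝ (tangentConeAt ℝ M p)

/-- `W` is a `C¹` vector field near `p`, tangent to `M` along `M`, with `W(p) = w`. -/
def IsTangentExtension (M : Set E) (p w : E) (W : E → E) : Prop :=
  ContDiffAt ℝ 1 W p ∧ W p = w ∧ ∀ᶠ q in 𝓝[M] p, W q ∈ tangentPlane M q

open Classical in
/-- The second fundamental form `II(v, w) = (D_v W)^⊥` of `M` at `p`, where `v, w ∈ T_p M` and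
`W` is any tangential `C¹` extension of `w` (on a `C²` submanifold such extensions exist and
the value does not depend on the choice). -/
def secondFundamentalForm (M : Set E) (p v w : E) : E :=
  if h : ∃ W : E → E, IsTangentExtension M p w W then
    (tangentPlane M p)ᗮ.starProjection (fderiv ℝ h.choose p v)
  else 0

/-- The mean curvature vector `H_M(p) = ∑ᵢ II(eᵢ, eᵢ)`, where `(eᵢ)` is an orthonormal basis
of `T_p M`. -/
def meanCurvature (M : Set E) (p : E) : E :=
  ∑ i, secondFundamentalForm M p
    (stdOrthonormalBasis ℝ (tangentPlane M p) i) (stdOrthonormalBasis ℝ (tangentPlane M p) i)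

end Curvature

/-! ### The Grassmannian and varifolds -/

/-- The Grassmannian of (unoriented) `m`-dimensional linear subspaces of `E`. -/
def Gr (m : ℕ) (E : Type*) [NormedAddCommGroup E] [InnerProductSpace ℝ E] : Type _ :=
  {S : Submodule ℝ E // Module.finrank ℝ S = m}

section Varifold

variable {E : Type*} [NormedAddCommGroup E] [InnerProductSpace ℝ E] [FiniteDimensional ℝ E]
  {m : ℕ}

/-- The orthogonal projection onto an element of the Grassmannian. -/
def Gr.proj (S : Gr m E) : E →L[ℝ] E := S.1.starProjection

/-- The usual topology: planes are close if their orthogonal projections are. -/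
instance : TopologicalSpace (Gr m E) := TopologicalSpace.induced Gr.proj inferInstance

instance : MeasurableSpace (Gr m E) := borel _

/-- `div_S X (x) = ∑ᵢ ⟨eᵢ, D_{eᵢ} X(x)⟩ = trace (p_S ∘ DX(x))`, with `(eᵢ)` an orthonormal
basis of `S`. -/
def divAlong (S : Gr m E) (X : E → E) (x : E) : ℝ :=
  LinearMap.trace ℝ E (S.proj ∘L fderiv ℝ X x : E →L[ℝ] E)

variable [MeasurableSpace E]

/-- The weight `‖V‖` of a varifold: the marginal of `V` on the ambient space. -/
def weight (V : Measure (E × Gr m E)) : Measure E := V.map Prod.fst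

/-- An `m`-dimensional varifold in `U`: a Radon measure on `U × Gr m E`, regarded as a measure on
`E × Gr m E` which vanishes outside of `U × Gr m E`. -/
def IsVarifold (U : Set E) (V : Measure (E × Gr m E)) : Prop :=
  V (Uᶜ ×ˢ univ) = 0 ∧ ∀ K ⊆ U, IsCompact K → V (K ×ˢ univ) < ⊤

/-- The support of (the weight of) a varifold in `U`, which is a relatively closed subset
of `U`. -/
def vsupp (U : Set E) (V : Measure (E × Gr m E)) : Set E := (weight V).support ∩ U

/-- `V` is stationary in `U`: the first variation `δV(X) = ∫ div_S X(x) dV(x, S)` vanishes for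
every `X ∈ C_c^∞(U, E)`. -/
def IsStationary (U : Set E) (V : Measure (E × Gr m E)) : Prop :=
  ∀ X : E → E, ContDiff ℝ ∞ X → HasCompactSupport X → tsupport X ⊆ U →
    ∫ q, divAlong q.2 X q.1 ∂V = 0

variable [BorelSpace E]

/-- `A` is (countably) `m`-rectifiable: `ℋ^m`-almost all of `A` is covered by countably many
Lipschitz images of `ℝ^m`. -/
def IsRectifiable (m : ℕ) (A : Set E) : Prop :=
  ∃ f : ℕ → EuclideanSpace ℝ (Fin m) → E,
    (∀ i, ∃ K : ℝ≥0, LipschitzWith K (f i)) ∧ μHE[m] (A \ ⋃ i, range (f i)) = 0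

/-- `S` is the approximate tangent plane of `A` at `x`: the blow-ups of `ℋ^m ⌞ A` at `x`
converge to `ℋ^m ⌞ S` in duality with `C_c`. -/
def IsApproxTangent (A : Set E) (x : E) (S : Gr m E) : Prop :=
  ∀ φ : E → ℝ, Continuous φ → HasCompactSupport φ →
    Tendsto (fun r : ℝ => (r ^ m)⁻¹ * ∫ y in A, φ (r⁻¹ • (y - x)) ∂μHE[m]) (𝓝[>] 0)
      (𝓝 (∫ y in (S.1 : Set E), φ y ∂μHE[m]))

/-- `V` is an integer rectifiable `m`-varifold in `U`: `‖V‖ = Θ ℋ^m ⌞ A` with `A ⊆ U`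
`m`-rectifiable and `Θ` Borel with positive integer values, and `V` disintegrates with respect
to `‖V‖` into the Dirac masses at the approximate tangent planes of `A`. -/
def IsIntegralVarifold (U : Set E) (V : Measure (E × Gr m E)) : Prop :=
  IsVarifold U V ∧
  ∃ (A : Set E) (Θ : E → ℕ) (T : E → Gr m E),
    A ⊆ U ∧ MeasurableSet A ∧ IsRectifiable m A ∧
    Measurable Θ ∧ (∀ᵐ x ∂((μHE[m] : Measure E).restrict A), 1 ≤ Θ x) ∧
    weight V = ((μHE[m] : Measure E).restrict A).withDensity (fun x => (Θ x : ℝ≥0∞)) ∧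
    Measurable T ∧ (∀ᵐ x ∂(weight V), IsApproxTangent A x (T x)) ∧
    V = (weight V).map (fun x => (x, T x))

end Varifold

end HeightBound

end

/-!
Testing stationarity with `u ∇h - h ∇u`, where `u` is a truncated and regularized fundamental
solution of the `m`-dimensional Laplacian, yields a mean value inequality for every nonnegative `h`
whose Laplacian along each `m`-plane is nonnegative. It is applied to a perturbation of the squared
height `|y - g x|²` over the graph of `g`. Along a plane `S`, half the Laplacian of the squared
height is at least the squared tilt of `S` against the graph minus error terms; the part of the
second derivative of `g` that survives when `S` is parallel to the graph is the mean curvature, and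
the rest is controlled by the tilt times the height. Hence a multiple of `|H_M|²` times the squared
distance to the center absorbs the mean curvature, and a small multiple of that squared distance
times the squared height absorbs the remaining error. At points where the density of the varifold
is bounded below, the mean value inequality becomes a pointwise bound, which extends to the support
by continuity.
-/

noncomputable section

namespace HeightBound

open scoped RealInnerProductSpace Gradient

section Trace

variable {E : Type*} [NormedAddCommGroup E] [InnerProductSpace ℝ E]
variable {ι κ κ' : Type*} [Fintype ι] [Fintype κ] [Fintype κ']

theorem norm_orthonormalBasis_coe {S : Submodule ℝ E} (e : OrthonormalBasis κ ℝ S) (j : κ) :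
    ‖(e j : E)‖ = 1 :=
  e.orthonormal.1 j

variable [FiniteDimensional ℝ E]

theorem starProjection_eq_sum_inner {S : Submodule ℝ E} (e : OrthonormalBasis κ ℝ S) (x : E) :
    S.starProjection x = ∑ j, ⟪(e j : E), x⟫ • (e j : E) := by
  simp [e.starProjection_eq_sum_rankOne, InnerProductSpace.rankOne_apply]

theorem norm_sq_starProjection (S : Submodule ℝ E) (x : E) :
    ‖S.starProjection x‖ ^ 2 = ⟪x, S.starProjection x⟫ := by
  rw [← real_inner_self_eq_norm_sq, S.inner_starProjection_left_eq_right,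
    S.starProjection_eq_self_iff.2 (S.starProjection_apply_mem x)]

theorem sum_bilin_starProjection {G : Type*} [AddCommGroup G] [Module ℝ G]
    (B : E →ₗ[ℝ] E →ₗ[ℝ] G) (b : OrthonormalBasis ι ℝ E) {S : Submodule ℝ E}
    (e : OrthonormalBasis κ ℝ S) :
    ∑ i, B (b i) (S.starProjection (b i)) = ∑ j, B (e j) (e j) := by
  simp_rw [starProjection_eq_sum_inner e, map_sum, map_smul]
  rw [Finset.sum_comm]
  refine Finset.sum_congr rfl fun j _ => ?_
  calc ∑ i, ⟪(e j : E), b i⟫ • B (b i) (e j)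
      = B (∑ i, ⟪b i, (e j : E)⟫ • b i) (e j) := by
        simp only [map_sum, map_smul, LinearMap.sum_apply, LinearMap.smul_apply, real_inner_comm]
    _ = B (e j) (e j) := by rw [b.sum_repr']

theorem sum_inner_starProjection (b : OrthonormalBasis ι ℝ E) (T : Submodule ℝ E)
    {S : Submodule ℝ E} (e : OrthonormalBasis κ ℝ S) :
    ∑ i, ⟪T.starProjection (b i), S.starProjection (b i)⟫
      = ∑ j, ‖T.starProjection (e j : E)‖ ^ 2 := by
  have h := sum_bilin_starProjection ((innerₗ E).comp (T.starProjection : E →ₗ[ℝ] E)) b e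
  simp only [LinearMap.comp_apply, innerₗ_apply_apply, ContinuousLinearMap.coe_coe] at h
  simp only [h, norm_sq_starProjection, real_inner_comm]

theorem sum_norm_sq_starProjection (b : OrthonormalBasis ι ℝ E) {S : Submodule ℝ E}
    (e : OrthonormalBasis κ ℝ S) : ∑ i, ‖S.starProjection (b i)‖ ^ 2 = Fintype.card κ := by
  have h := sum_inner_starProjection b S e
  simp only [real_inner_self_eq_norm_sq, S.starProjection_eq_self_iff.2 (e _).2,
    norm_orthonormalBasis_coe] at h
  simpa using h

theorem sum_norm_sq_starProjection_sub (b : OrthonormalBasis ι ℝ E) {S T : Submodule ℝ E}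
    (e : OrthonormalBasis κ ℝ S) (e' : OrthonormalBasis κ' ℝ T)
    (hcard : Fintype.card κ = Fintype.card κ') :
    ∑ i, ‖S.starProjection (b i) - T.starProjection (b i)‖ ^ 2
      = 2 * ∑ j, ‖Tᗮ.starProjection (e j : E)‖ ^ 2 := by
  have hperp (j : κ) :
      ‖Tᗮ.starProjection (e j : E)‖ ^ 2 = 1 - ‖T.starProjection (e j : E)‖ ^ 2 := by
    have := Submodule.norm_sq_eq_add_norm_sq_starProjection (e j : E) T
    rw [norm_orthonormalBasis_coe] at this
    linarith
  simp_rw [norm_sub_rev (S.starProjection _), norm_sub_sq_real, hperp]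
  rw [Finset.sum_add_distrib, Finset.sum_sub_distrib, ← Finset.mul_sum, Finset.sum_sub_distrib,
    sum_norm_sq_starProjection b e, sum_norm_sq_starProjection b e',
    sum_inner_starProjection b T e, ← hcard]
  simp only [Finset.sum_const, Finset.card_univ, nsmul_eq_mul]
  ring

theorem abs_sum_bilin_sub_le (B : E →L[ℝ] E →L[ℝ] ℝ) {S T : Submodule ℝ E}
    (e : OrthonormalBasis κ ℝ S) (e' : OrthonormalBasis κ' ℝ T)
    (hcard : Fintype.card κ = Fintype.card κ') :
    |∑ j, B (e j) (e j) - ∑ j, B (e' j) (e' j)|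
      ≤ ‖B‖ * √(Module.finrank ℝ E * (2 * ∑ j, ‖Tᗮ.starProjection (e j : E)‖ ^ 2)) := by
  set b := stdOrthonormalBasis ℝ E
  have hS : ∑ i, B (b i) (S.starProjection (b i)) = ∑ j, B (e j) (e j) :=
    sum_bilin_starProjection B.toLinearMap₁₂ b e
  have hT : ∑ i, B (b i) (T.starProjection (b i)) = ∑ j, B (e' j) (e' j) :=
    sum_bilin_starProjection B.toLinearMap₁₂ b e'
  rw [← hS, ← hT, ← Finset.sum_sub_distrib, ← sum_norm_sq_starProjection_sub b e e' hcard]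
  calc |∑ i, (B (b i) (S.starProjection (b i)) - B (b i) (T.starProjection (b i)))|
      ≤ ∑ i, ‖B‖ * ‖S.starProjection (b i) - T.starProjection (b i)‖ := by
        refine (Finset.abs_sum_le_sum_abs _ _).trans (Finset.sum_le_sum fun i _ => ?_)
        rw [← map_sub]
        simpa [b.orthonormal.1 i] using
          B.le_opNorm₂ (b i) (S.starProjection (b i) - T.starProjection (b i))
    _ = ‖B‖ * ∑ i, ‖S.starProjection (b i) - T.starProjection (b i)‖ := by rw [Finset.mul_sum]
    _ ≤ _ := by
        gcongr
        refine Real.le_sqrt_of_sq_le ?_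
        simpa using sq_sum_le_card_mul_sum_sq (s := Finset.univ)
          (f := fun i => ‖S.starProjection (b i) - T.starProjection (b i)‖)

theorem norm_sq_map_starProjection_le {G : Type*} [NormedAddCommGroup G] [NormedSpace ℝ G]
    (L : E →L[ℝ] G) {S : Submodule ℝ E} (e : OrthonormalBasis κ ℝ S) (x : E) :
    ‖L (S.starProjection x)‖ ^ 2 ≤ (∑ j, ‖L (e j)‖ ^ 2) * ‖x‖ ^ 2 := by
  have htriangle : ‖L (S.starProjection x)‖ ≤ ∑ j, |⟪(e j : E), x⟫| * ‖L (e j)‖ := by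
    rw [starProjection_eq_sum_inner e, map_sum]
    refine (norm_sum_le _ _).trans (Finset.sum_le_sum fun j _ => ?_)
    rw [map_smul, norm_smul, Real.norm_eq_abs]
  have hBessel : ∑ j, ⟪(e j : E), x⟫ ^ 2 ≤ ‖x‖ ^ 2 := by
    have he : Orthonormal ℝ (fun j => (e j : E)) := by
      simpa [Function.comp_def] using e.orthonormal.comp_linearIsometry S.subtypeₗᵢ
    simpa using he.sum_inner_products_le x (s := Finset.univ)
  calc ‖L (S.starProjection x)‖ ^ 2 ≤ (∑ j, |⟪(e j : E), x⟫| * ‖L (e j)‖) ^ 2 := by gcongr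
    _ ≤ (∑ j, |⟪(e j : E), x⟫| ^ 2) * ∑ j, ‖L (e j)‖ ^ 2 :=
        Finset.sum_mul_sq_le_sq_mul_sq _ _ _
    _ = (∑ j, ‖L (e j)‖ ^ 2) * ∑ j, ⟪(e j : E), x⟫ ^ 2 := by simp only [sq_abs, mul_comm]
    _ ≤ (∑ j, ‖L (e j)‖ ^ 2) * ‖x‖ ^ 2 := by gcongr

end Trace

section Laplacian

variable {E : Type*} [NormedAddCommGroup E] [InnerProductSpace ℝ E]

theorem contDiff_norm_sub_sq {k : WithTop ℕ∞} (p : E) : ContDiff ℝ k fun z => ‖z - p‖ ^ 2 :=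
  (contDiff_fun_id.sub contDiff_const).norm_sq ℝ

theorem fderiv_fderiv_norm_sq {G : Type*} [NormedAddCommGroup G] [InnerProductSpace ℝ G]
    {F : E → G} {x : E} (hF : ContDiffAt ℝ 2 F x) (v w : E) :
    fderiv ℝ (fderiv ℝ fun z => ‖F z‖ ^ 2) x v w
      = 2 * (⟪fderiv ℝ F x v, fderiv ℝ F x w⟫ + ⟪F x, fderiv ℝ (fderiv ℝ F) x v w⟫) := by
  have hfirst : (fderiv ℝ fun z => ‖F z‖ ^ 2)
      =ᶠ[𝓝 x] fun z => (2 : ℝ) • innerSL ℝ (F z) ∘L fderiv ℝ F z := by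
    filter_upwards [hF.eventually (by simp)] with z hFz
    have := (hFz.differentiableAt two_ne_zero).hasFDerivAt.norm_sq
    simpa [← Nat.cast_smul_eq_nsmul ℝ] using this.fderiv
  have hDF : HasFDerivAt (fderiv ℝ F) (fderiv ℝ (fderiv ℝ F) x) x :=
    ((hF.fderiv_right (m := 1) le_rfl).differentiableAt one_ne_zero).hasFDerivAt
  have hinner : HasFDerivAt (fun z => innerSL ℝ (F z)) (innerSL ℝ ∘L fderiv ℝ F x) x :=
    (innerSL ℝ (E := G)).hasFDerivAt.comp x (hF.differentiableAt two_ne_zero).hasFDerivAt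
  rw [hfirst.fderiv_eq, ((hinner.clm_comp hDF).fun_const_smul (2 : ℝ)).fderiv, add_comm]
  rfl

variable [FiniteDimensional ℝ E] {m : ℕ} {f g : E → ℝ} {x : E}

theorem Gr.inner_proj (S : Gr m E) (v w : E) : ⟪S.proj v, w⟫ = ⟪v, S.proj w⟫ :=
  S.1.inner_starProjection_left_eq_right v w

theorem divAlong_congr (S : Gr m E) {X Y : E → E} (h : X =ᶠ[𝓝 x] Y) :
    divAlong S X x = divAlong S Y x := by
  rw [divAlong, divAlong, h.fderiv_eq]

theorem divAlong_eq_sum {κ : Type*} [Fintype κ] (S : Gr m E) (e : OrthonormalBasis κ ℝ S.1)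
    (X : E → E) (x : E) : divAlong S X x = ∑ j, ⟪(e j : E), fderiv ℝ X x (e j)⟫ := by
  set b := stdOrthonormalBasis ℝ E
  have htrace := sum_bilin_starProjection ((innerₗ E).comp (fderiv ℝ X x : E →ₗ[ℝ] E)) b e
  simp only [LinearMap.comp_apply, innerₗ_apply_apply, ContinuousLinearMap.coe_coe] at htrace
  simp only [real_inner_comm _ (e _ : E)]
  rw [divAlong, LinearMap.trace_eq_sum_inner _ b, ← htrace]
  refine Finset.sum_congr rfl fun i _ => ?_
  rw [ContinuousLinearMap.coe_coe, ContinuousLinearMap.comp_apply, ← Gr.inner_proj, real_inner_comm]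
  rfl

theorem divAlong_add (S : Gr m E) {X Y : E → E} (hX : DifferentiableAt ℝ X x)
    (hY : DifferentiableAt ℝ Y x) :
    divAlong S (fun z => X z + Y z) x = divAlong S X x + divAlong S Y x := by
  simp [divAlong, fderiv_fun_add hX hY, ContinuousLinearMap.comp_add]

theorem divAlong_sub (S : Gr m E) {X Y : E → E} (hX : DifferentiableAt ℝ X x)
    (hY : DifferentiableAt ℝ Y x) :
    divAlong S (fun z => X z - Y z) x = divAlong S X x - divAlong S Y x := by
  simp [divAlong, fderiv_fun_sub hX hY, ContinuousLinearMap.comp_sub]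

theorem divAlong_smul (S : Gr m E) {X : E → E} (hf : DifferentiableAt ℝ f x)
    (hX : DifferentiableAt ℝ X x) :
    divAlong S (fun z => f z • X z) x = f x * divAlong S X x + ⟪∇ f x, S.proj (X x)⟫ := by
  have hrank : ((S.proj ∘L (fderiv ℝ f x).smulRight (X x) : E →L[ℝ] E) : E →ₗ[ℝ] E)
      = (fderiv ℝ f x : E →ₗ[ℝ] ℝ).smulRight (S.proj (X x)) := by
    ext v; simp
  rw [divAlong, fderiv_fun_smul hf hX, ContinuousLinearMap.comp_add,
    ContinuousLinearMap.toLinearMap_add, map_add, hrank, LinearMap.trace_smulRight,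
    inner_gradient_left]
  simp [divAlong]

/-- The Laplacian `Δ_S f (x) = div_S (∇f) (x)` of `f` along the plane `S`, i.e. the trace over `S`
of the Hessian of `f`; integrated against a stationary varifold it plays the role of the
Laplace–Beltrami operator of a minimal submanifold. -/
def laplacianAlong (S : Gr m E) (f : E → ℝ) (x : E) : ℝ := divAlong S (∇ f) x

theorem contDiff_toDual_symm {k : WithTop ℕ∞} :
    ContDiff ℝ k (InnerProductSpace.toDual ℝ E).symm :=
  IsBoundedLinearMap.contDiff
    ⟨⟨map_add _, fun c y => by simp⟩, 1, one_pos, fun y => by simp⟩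

theorem contDiffAt_gradient {k : WithTop ℕ∞} (hf : ContDiffAt ℝ (k + 1) f x) :
    ContDiffAt ℝ k (∇ f) x :=
  contDiff_toDual_symm.contDiffAt.comp x (hf.fderiv_right le_rfl)

theorem differentiableAt_gradient (hf : ContDiffAt ℝ 2 f x) : DifferentiableAt ℝ (∇ f) x :=
  (contDiffAt_gradient (k := 1) hf).differentiableAt one_ne_zero

theorem laplacianAlong_eq_sum {κ : Type*} [Fintype κ] (S : Gr m E)
    (e : OrthonormalBasis κ ℝ S.1) (hf : ContDiffAt ℝ 2 f x) :
    laplacianAlong S f x = ∑ j, fderiv ℝ (fderiv ℝ f) x (e j) (e j) := by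
  rw [laplacianAlong, divAlong_eq_sum S e]
  refine Finset.sum_congr rfl fun j _ => ?_
  have hgrad : HasFDerivAt (fun y => ⟪(e j : E), ∇ f y⟫)
      (innerSL ℝ (e j : E) ∘L fderiv ℝ (∇ f) x) x :=
    (innerSL ℝ (e j : E)).hasFDerivAt.comp x (differentiableAt_gradient hf).hasFDerivAt
  have hfderiv : HasFDerivAt (fun y => fderiv ℝ f y (e j))
      ((fderiv ℝ (fderiv ℝ f) x).flip (e j)) x := by
    have hdf : DifferentiableAt ℝ (fderiv ℝ f) x :=
      (hf.fderiv_right (m := 1) le_rfl).differentiableAt one_ne_zero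
    simpa using hdf.hasFDerivAt.clm_apply (hasFDerivAt_const (e j : E) x)
  simp only [real_inner_comm _ (e j : E), inner_gradient_left] at hgrad
  exact DFunLike.congr_fun (hgrad.unique hfderiv) (e j : E)

theorem gradient_add (hf : DifferentiableAt ℝ f x) (hg : DifferentiableAt ℝ g x) :
    ∇ (fun z => f z + g z) x = ∇ f x + ∇ g x := by
  simp [gradient, fderiv_fun_add hf hg]

theorem gradient_mul (hf : DifferentiableAt ℝ f x) (hg : DifferentiableAt ℝ g x) :
    ∇ (fun z => f z * g z) x = f x • ∇ g x + g x • ∇ f x := by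
  simp [gradient, fderiv_fun_mul hf hg]

theorem gradient_comp {Φ : ℝ → ℝ} (hΦ : DifferentiableAt ℝ Φ (f x)) (hf : DifferentiableAt ℝ f x) :
    ∇ (fun z => Φ (f z)) x = deriv Φ (f x) • ∇ f x := by
  refine HasGradientAt.gradient ?_
  rw [hasGradientAt_iff_hasFDerivAt]
  simpa [Function.comp_def] using hΦ.hasDerivAt.comp_hasFDerivAt x hf.hasFDerivAt

theorem laplacianAlong_add (S : Gr m E) (hf : ContDiffAt ℝ 2 f x) (hg : ContDiffAt ℝ 2 g x) :
    laplacianAlong S (fun z => f z + g z) x = laplacianAlong S f x + laplacianAlong S g x := by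
  rw [laplacianAlong, divAlong_congr S (Y := fun z => ∇ f z + ∇ g z) ?_,
    divAlong_add S (differentiableAt_gradient hf) (differentiableAt_gradient hg)]
  · rfl
  filter_upwards [hf.eventually (by simp), hg.eventually (by simp)] with z hfz hgz
  exact gradient_add (hfz.differentiableAt two_ne_zero) (hgz.differentiableAt two_ne_zero)

theorem laplacianAlong_mul (S : Gr m E) (hf : ContDiffAt ℝ 2 f x) (hg : ContDiffAt ℝ 2 g x) :
    laplacianAlong S (fun z => f z * g z) x
      = f x * laplacianAlong S g x + g x * laplacianAlong S f x
        + 2 * ⟪S.proj (∇ f x), ∇ g x⟫ := by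
  have hf' := hf.differentiableAt two_ne_zero
  have hg' := hg.differentiableAt two_ne_zero
  have hdf := differentiableAt_gradient hf
  have hdg := differentiableAt_gradient hg
  rw [laplacianAlong, divAlong_congr S (Y := fun z => f z • ∇ g z + g z • ∇ f z) ?_,
    divAlong_add S (hf'.fun_smul hdg) (hg'.fun_smul hdf), divAlong_smul S hf' hdg,
    divAlong_smul S hg' hdf, ← Gr.inner_proj, real_inner_comm (S.proj (∇ f x))]
  · simp only [laplacianAlong]
    ring
  filter_upwards [hf.eventually (by simp), hg.eventually (by simp)] with z hfz hgz
  exact gradient_mul (hfz.differentiableAt two_ne_zero) (hgz.differentiableAt two_ne_zero)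

theorem laplacianAlong_const_mul (S : Gr m E) (c : ℝ) (hf : ContDiffAt ℝ 2 f x) :
    laplacianAlong S (fun z => c * f z) x = c * laplacianAlong S f x := by
  have hgrad : ∇ (fun _ : E => c) = 0 := by ext; simp
  have hlap : laplacianAlong S (fun _ => c) x = 0 := by
    simp [laplacianAlong, hgrad, divAlong]
  rw [laplacianAlong_mul S contDiffAt_const hf, hlap, hgrad]
  simp

theorem laplacianAlong_comp (S : Gr m E) {Φ : ℝ → ℝ} (hΦ : ContDiff ℝ 2 Φ)
    (hf : ContDiffAt ℝ 2 f x) :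
    laplacianAlong S (fun z => Φ (f z)) x
      = deriv Φ (f x) * laplacianAlong S f x
        + deriv (deriv Φ) (f x) * ⟪∇ f x, S.proj (∇ f x)⟫ := by
  have hΦ' : Differentiable ℝ (deriv Φ) :=
    ((contDiff_succ_iff_deriv (n := 1)).1 hΦ).2.2.differentiable one_ne_zero
  have hf' := hf.differentiableAt two_ne_zero
  have hcomp : DifferentiableAt ℝ (fun z => deriv Φ (f z)) x := (hΦ' _).comp x hf'
  rw [laplacianAlong, divAlong_congr S (Y := fun z => deriv Φ (f z) • ∇ f z) ?_,
    divAlong_smul S hcomp (differentiableAt_gradient hf), gradient_comp (hΦ' _) hf',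
    real_inner_smul_left, laplacianAlong]
  filter_upwards [hf.eventually (by simp)] with z hfz
  exact gradient_comp (hΦ.differentiable two_ne_zero _) (hfz.differentiableAt two_ne_zero)

theorem laplacianAlong_norm_sq {G : Type*} [NormedAddCommGroup G] [InnerProductSpace ℝ G]
    {F : E → G} {κ : Type*} [Fintype κ] (S : Gr m E) (e : OrthonormalBasis κ ℝ S.1)
    (hF : ContDiffAt ℝ 2 F x) :
    laplacianAlong S (fun z => ‖F z‖ ^ 2) x
      = 2 * ∑ j, (‖fderiv ℝ F x (e j)‖ ^ 2 + ⟪F x, fderiv ℝ (fderiv ℝ F) x (e j) (e j)⟫) := by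
  simp only [laplacianAlong_eq_sum S e (hF.norm_sq ℝ), fderiv_fderiv_norm_sq hF,
    real_inner_self_eq_norm_sq, Finset.mul_sum]

theorem gradient_norm_sub_sq (p x : E) : ∇ (fun z => ‖z - p‖ ^ 2) x = (2 : ℝ) • (x - p) := by
  refine ext_inner_right ℝ fun v => ?_
  rw [inner_gradient_left, (hasFDerivAt_sub_const p).norm_sq.fderiv]
  simp [real_inner_smul_left, inner_sub_left]

theorem laplacianAlong_norm_sub_sq (S : Gr m E) (p x : E) :
    laplacianAlong S (fun z => ‖z - p‖ ^ 2) x = 2 * m := by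
  have hfderiv : fderiv ℝ (fun z => z - p) = fun _ => ContinuousLinearMap.id ℝ E := by
    ext1 z
    exact (hasFDerivAt_sub_const p).fderiv
  rw [laplacianAlong_norm_sq S (stdOrthonormalBasis ℝ S.1) (contDiffAt_fun_id.sub contDiffAt_const),
    hfderiv]
  simp [norm_orthonormalBasis_coe, S.2]

end Laplacian

section RadialKernel

/-- A nonincreasing smooth cutoff on the line, equal to `1` on `(-∞, R / 2]` and to `0` on
`[R, ∞)`. -/
def cutoff (R t : ℝ) : ℝ := Real.smoothTransition (2 - 2 * t / R)

theorem contDiff_cutoff (R : ℝ) {k : ℕ∞} : ContDiff ℝ k (cutoff R) :=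
  Real.smoothTransition.contDiff.comp (by fun_prop)

theorem cutoff_nonneg (R t : ℝ) : 0 ≤ cutoff R t := Real.smoothTransition.nonneg _

variable {R t : ℝ}

theorem cutoff_of_le_half (hR : 0 < R) (ht : t ≤ R / 2) : cutoff R t = 1 :=
  Real.smoothTransition.one_of_one_le <| by
    have : 2 * t / R ≤ 1 := by rw [div_le_one hR]; linarith
    linarith

theorem cutoff_of_ge (hR : 0 < R) (ht : R ≤ t) : cutoff R t = 0 :=
  Real.smoothTransition.zero_of_nonpos <| by
    have : 2 ≤ 2 * t / R := by rw [le_div_iff₀ hR]; linarith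
    linarith

theorem antitone_cutoff (hR : 0 < R) : Antitone (cutoff R) := fun _ _ hab =>
  Real.smoothTransition.monotone (by gcongr)

theorem deriv_cutoff_of_le_half (hR : 0 < R) (ht : t ≤ R / 2) : deriv (cutoff R) t = 0 :=
  IsLocalMax.deriv_eq_zero <| Eventually.of_forall fun s => by
    rw [cutoff_of_le_half hR ht]
    exact Real.smoothTransition.le_one _

theorem deriv_cutoff_of_ge (hR : 0 < R) (ht : R ≤ t) : deriv (cutoff R) t = 0 :=
  IsLocalMin.deriv_eq_zero <| Eventually.of_forall fun s => by
    rw [cutoff_of_ge hR ht]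
    exact cutoff_nonneg R s

theorem exists_abs_deriv_cutoff_le (R : ℝ) :
    ∃ K, 0 < K ∧ ∀ t ∈ Icc (R / 2) R, |deriv (cutoff R) t| ≤ K := by
  have hcont : Continuous (deriv (cutoff R)) :=
    (contDiff_cutoff R (k := 1)).continuous_deriv le_rfl
  obtain ⟨K, hK⟩ :=
    isCompact_Icc.exists_bound_of_continuousOn (hcont.continuousOn (s := Icc (R / 2) R))
  exact ⟨max K 1, by positivity, fun t ht => (hK t ht).trans (le_max_left _ _)⟩

/-- A regularization at scale `σ` of `|x| ^ (-m)`, as a function of `t = |x| ^ 2`. -/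
def regPow (m : ℕ) (σ t : ℝ) : ℝ := (t ^ 2 + σ ^ 4) ^ (-(m / 4) : ℝ)

variable {m : ℕ} {σ : ℝ}

theorem regPow_pos (hσ : 0 < σ) : 0 < regPow m σ t := Real.rpow_pos_of_pos (by positivity) _

theorem contDiff_regPow (hσ : 0 < σ) {k : WithTop ℕ∞} : ContDiff ℝ k (regPow m σ) :=
  ContDiff.rpow_const_of_ne (by fun_prop) fun t => by positivity

theorem hasDerivAt_regPow (hσ : 0 < σ) (t : ℝ) :
    HasDerivAt (regPow m σ) (-(m / 2) * (t / (t ^ 2 + σ ^ 4)) * regPow m σ t) t := by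
  have hpos : 0 < t ^ 2 + σ ^ 4 := by positivity
  have hbase : HasDerivAt (fun t : ℝ => t ^ 2 + σ ^ 4) (2 * t) t := by
    simpa using (hasDerivAt_pow 2 t).add_const (σ ^ 4)
  refine (hbase.rpow_const (p := -(m / 4 : ℝ)) (Or.inl hpos.ne')).congr_deriv ?_
  rw [Real.rpow_sub_one hpos.ne', regPow]
  field_simp
  ring

/-- The truncation of `regPow` at `t = R`. -/
def truncPow (m : ℕ) (R σ t : ℝ) : ℝ := regPow m σ t * cutoff R t

theorem contDiff_truncPow (m : ℕ) (R : ℝ) (hσ : 0 < σ) {k : ℕ∞} : ContDiff ℝ k (truncPow m R σ) :=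
  (contDiff_regPow hσ).mul (contDiff_cutoff R)

theorem truncPow_nonneg (hσ : 0 < σ) : 0 ≤ truncPow m R σ t :=
  mul_nonneg (regPow_pos hσ).le (cutoff_nonneg R t)

theorem truncPow_of_ge (hR : 0 < R) (ht : R ≤ t) : truncPow m R σ t = 0 := by
  rw [truncPow, cutoff_of_ge hR ht, mul_zero]

theorem deriv_truncPow (hσ : 0 < σ) :
    deriv (truncPow m R σ) t
      = -(m / 2) * (t / (t ^ 2 + σ ^ 4)) * truncPow m R σ t
        + regPow m σ t * deriv (cutoff R) t := by
  have hcutoff := ((contDiff_cutoff R (k := 1)).differentiable one_ne_zero t).hasDerivAt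
  refine ((hasDerivAt_regPow hσ t).mul hcutoff).deriv.trans ?_
  rw [truncPow, mul_assoc _ (regPow m σ t)]

theorem deriv_truncPow_nonpos (hR : 0 < R) (hσ : 0 < σ) (ht : 0 ≤ t) :
    deriv (truncPow m R σ) t ≤ 0 := by
  have hpow : 0 ≤ (m / 2 : ℝ) * (t / (t ^ 2 + σ ^ 4)) * truncPow m R σ t := by
    have := truncPow_nonneg (m := m) (R := R) (t := t) hσ
    positivity
  have hcut : regPow m σ t * deriv (cutoff R) t ≤ 0 :=
    mul_nonpos_of_nonneg_of_nonpos (regPow_pos hσ).le (antitone_cutoff hR).deriv_nonpos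
  rw [deriv_truncPow hσ]
  linarith

/-- The value of `-Δ (Φ (|x| ^ 2))` on `ℝ ^ m` at `|x| ^ 2 = t`, where `Φ' = -η`. -/
def radialCharge (m : ℕ) (η : ℝ → ℝ) (t : ℝ) : ℝ := 2 * m * η t + 4 * t * deriv η t

theorem radialCharge_truncPow (hσ : 0 < σ) :
    radialCharge m (truncPow m R σ) t
      = 2 * m * (σ ^ 4 / (t ^ 2 + σ ^ 4)) * truncPow m R σ t
        + 4 * t * (regPow m σ t * deriv (cutoff R) t) := by
  have : 0 < t ^ 2 + σ ^ 4 := by positivity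
  rw [radialCharge, deriv_truncPow hσ]
  field_simp
  ring

theorem regPow_le_of_half_le (hR : 0 < R) (ht : R / 2 ≤ t) :
    regPow m σ t ≤ ((R / 2) ^ 2) ^ (-(m / 4) : ℝ) := by
  refine Real.rpow_le_rpow_of_nonpos (by positivity) ?_ (neg_nonpos.2 (by positivity))
  have : (R / 2) ^ 2 ≤ t ^ 2 := by gcongr
  linarith [show 0 ≤ σ ^ 4 by positivity]

theorem exists_neg_le_radialCharge (m : ℕ) (hR : 0 < R) :
    ∃ K, 0 < K ∧ ∀ σ, 0 < σ → ∀ t, -K ≤ radialCharge m (truncPow m R σ) t := by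
  obtain ⟨K, hK, hderiv⟩ := exists_abs_deriv_cutoff_le R
  set A := ((R / 2) ^ 2) ^ (-(m / 4) : ℝ)
  have : 0 < A := Real.rpow_pos_of_pos (by positivity) _
  refine ⟨4 * R * (A * K), by positivity, fun σ hσ t => ?_⟩
  have hmain : 0 ≤ 2 * m * (σ ^ 4 / (t ^ 2 + σ ^ 4)) * truncPow m R σ t := by
    have := truncPow_nonneg (m := m) (R := R) (t := t) hσ
    positivity
  have herror : -(4 * R * (A * K)) ≤ 4 * t * (regPow m σ t * deriv (cutoff R) t) := by
    by_cases htR : t ∈ Icc (R / 2) R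
    · have : 0 ≤ t := (half_pos hR).le.trans htR.1
      have hneg : -deriv (cutoff R) t ≤ K := (neg_le_abs _).trans (hderiv t htR)
      have hneg0 : 0 ≤ -deriv (cutoff R) t := neg_nonneg.2 (antitone_cutoff hR).deriv_nonpos
      have hreg := regPow_le_of_half_le (m := m) (σ := σ) hR htR.1
      have hreg0 := (regPow_pos (m := m) (t := t) hσ).le
      rw [neg_le, ← mul_neg, ← mul_neg]
      have := htR.2
      gcongr
    · have hzero : deriv (cutoff R) t = 0 := by
        rcases lt_or_ge t (R / 2) with h | h
        · exact deriv_cutoff_of_le_half hR h.le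
        · exact deriv_cutoff_of_ge hR (not_le.1 fun h' => htR ⟨h, h'⟩).le
      rw [hzero, mul_zero, mul_zero, neg_nonpos]
      positivity
  rw [radialCharge_truncPow hσ]
  linarith

theorem le_regPow_of_le_sq (hσ : 0 < σ) (ht : 0 ≤ t) (htσ : t ≤ σ ^ 2) :
    (2 : ℝ) ^ (-(m / 4) : ℝ) / σ ^ m ≤ regPow m σ t := by
  have hpow : (σ ^ 4) ^ (-(m / 4) : ℝ) = (σ ^ m)⁻¹ := by
    rw [← Real.rpow_natCast σ 4, ← Real.rpow_mul hσ.le, ← Real.rpow_natCast σ m,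
      ← Real.rpow_neg hσ.le]
    congr 1
    push_cast
    ring
  calc (2 : ℝ) ^ (-(m / 4) : ℝ) / σ ^ m = (2 * σ ^ 4) ^ (-(m / 4) : ℝ) := by
        rw [Real.mul_rpow zero_le_two (by positivity), hpow, div_eq_mul_inv]
    _ ≤ regPow m σ t := by
        refine Real.rpow_le_rpow_of_nonpos (by positivity) ?_ (neg_nonpos.2 (by positivity))
        nlinarith

theorem le_radialCharge_of_le_sq (hσ : 0 < σ) (hσR : 2 * σ ^ 2 ≤ R) (ht : 0 ≤ t)
    (htσ : t ≤ σ ^ 2) :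
    m * 2 ^ (-(m / 4) : ℝ) / σ ^ m ≤ radialCharge m (truncPow m R σ) t := by
  have hR : 0 < R := by nlinarith [sq_pos_of_pos hσ]
  have htR : t ≤ R / 2 := by linarith
  have hhalf : 1 / 2 ≤ σ ^ 4 / (t ^ 2 + σ ^ 4) := by
    rw [div_le_div_iff₀ two_pos (by positivity)]
    nlinarith
  have hreg := le_regPow_of_le_sq (m := m) hσ ht htσ
  rw [radialCharge_truncPow hσ, deriv_cutoff_of_le_half hR htR, truncPow,
    cutoff_of_le_half hR htR, mul_zero, mul_zero, add_zero, mul_one]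
  calc (m * 2 ^ (-(m / 4) : ℝ) / σ ^ m : ℝ)
      = 2 * m * (1 / 2) * (2 ^ (-(m / 4) : ℝ) / σ ^ m) := by ring
    _ ≤ _ := by gcongr

/-- The primitive `Φ` of `-truncPow` vanishing on `[R, ∞)`: then `Φ (|x| ^ 2)` is a multiple of a
regularized and truncated fundamental solution of the Laplacian of `ℝ ^ m`. -/
def radialKernel (m : ℕ) (R σ t : ℝ) : ℝ := ∫ u in t..R, truncPow m R σ u

theorem hasDerivAt_radialKernel (hσ : 0 < σ) :
    HasDerivAt (radialKernel m R σ) (-truncPow m R σ t) t := by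
  have hcont : Continuous (truncPow m R σ) := (contDiff_truncPow m R hσ (k := 0)).continuous
  exact intervalIntegral.integral_hasDerivAt_left (hcont.intervalIntegrable _ _)
    (hcont.stronglyMeasurableAtFilter _ _) hcont.continuousAt

theorem deriv_radialKernel (hσ : 0 < σ) :
    deriv (radialKernel m R σ) = fun t => -truncPow m R σ t :=
  funext fun _ => (hasDerivAt_radialKernel hσ).deriv

theorem contDiff_radialKernel (m : ℕ) (R : ℝ) (hσ : 0 < σ) : ContDiff ℝ ∞ (radialKernel m R σ) := by
  rw [contDiff_infty_iff_deriv, deriv_radialKernel hσ]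
  exact ⟨fun t => (hasDerivAt_radialKernel hσ).differentiableAt, (contDiff_truncPow m R hσ).neg⟩

theorem radialKernel_of_ge (hR : 0 < R) (ht : R ≤ t) : radialKernel m R σ t = 0 := by
  rw [radialKernel, intervalIntegral.integral_congr (g := fun _ => 0),
    intervalIntegral.integral_zero]
  intro u hu
  rw [uIcc_of_ge ht] at hu
  exact truncPow_of_ge hR hu.1

theorem radialKernel_nonneg (hR : 0 < R) (hσ : 0 < σ) : 0 ≤ radialKernel m R σ t := by
  rcases le_total t R with h | h
  · exact intervalIntegral.integral_nonneg h fun _ _ => truncPow_nonneg hσ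
  · rw [radialKernel_of_ge hR h]

end RadialKernel

section Kernel

variable {E : Type*} [NormedAddCommGroup E]

/-- The regularized and truncated fundamental solution of `radialKernel`, centred at `p` and
supported in the ball of radius `ρ`, as a function on the ambient space. -/
def kernel (m : ℕ) (ρ σ : ℝ) (p z : E) : ℝ := radialKernel m (ρ ^ 2) σ (‖z - p‖ ^ 2)

variable {m : ℕ} {ρ σ : ℝ}

theorem kernel_nonneg (hρ : 0 < ρ) (hσ : 0 < σ) (p z : E) : 0 ≤ kernel m ρ σ p z :=
  radialKernel_nonneg (by positivity) hσ

theorem tsupport_kernel_subset (hρ : 0 < ρ) (p : E) :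
    tsupport (kernel m ρ σ p) ⊆ Metric.closedBall p ρ := by
  refine closure_minimal (fun z hz => ?_) Metric.isClosed_closedBall
  contrapose! hz
  rw [Metric.mem_closedBall, dist_eq_norm, not_le] at hz
  exact Function.notMem_support.2 (radialKernel_of_ge (by positivity) (by gcongr))

variable [InnerProductSpace ℝ E]

theorem contDiff_kernel (m : ℕ) (ρ : ℝ) (hσ : 0 < σ) (p : E) : ContDiff ℝ ∞ (kernel m ρ σ p) :=
  (contDiff_radialKernel m _ hσ).comp (contDiff_norm_sub_sq p)

variable [FiniteDimensional ℝ E]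

theorem laplacianAlong_kernel_le (hρ : 0 < ρ) (hσ : 0 < σ) (S : Gr m E) (p z : E) :
    laplacianAlong S (kernel m ρ σ p) z
      ≤ -radialCharge m (truncPow m (ρ ^ 2) σ) (‖z - p‖ ^ 2) := by
  have hproj : ⟪z - p, S.proj (z - p)⟫ ≤ ‖z - p‖ ^ 2 := by
    rw [Gr.proj, ← norm_sq_starProjection]
    gcongr
    exact S.1.norm_starProjection_apply_le _
  have hderiv : 0 ≤ -deriv (truncPow m (ρ ^ 2) σ) (‖z - p‖ ^ 2) :=
    neg_nonneg.2 (deriv_truncPow_nonpos (by positivity) hσ (by positivity))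
  have hlap := laplacianAlong_comp S (contDiff_infty.1 (contDiff_radialKernel m (ρ ^ 2) hσ) 2)
    (contDiff_norm_sub_sq p).contDiffAt (x := z)
  rw [deriv_radialKernel hσ, deriv.fun_neg, laplacianAlong_norm_sub_sq, gradient_norm_sub_sq,
    map_smul, real_inner_smul_left, real_inner_smul_right] at hlap
  have hmul := mul_le_mul_of_nonneg_left hproj hderiv
  rw [show laplacianAlong S (kernel m ρ σ p) z = _ from hlap, radialCharge]
  linarith

end Kernel

section FirstVariation

variable {E : Type*} [NormedAddCommGroup E] [InnerProductSpace ℝ E] [FiniteDimensional ℝ E]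
  {m : ℕ}

instance : BorelSpace (Gr m E) := ⟨rfl⟩

theorem Gr.continuous_proj : Continuous (Gr.proj : Gr m E → E →L[ℝ] E) :=
  continuous_induced_dom

instance : SecondCountableTopology (Gr m E) :=
  TopologicalSpace.secondCountableTopology_induced _ (E →L[ℝ] E) Gr.proj

theorem Gr.norm_proj_le (S : Gr m E) : ‖S.proj‖ ≤ 1 := S.1.starProjection_norm_le

theorem divAlong_eq_sum_stdOrthonormalBasis (S : Gr m E) (X : E → E) (x : E) :
    divAlong S X x = ∑ i, ⟪stdOrthonormalBasis ℝ E i,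
      S.proj (fderiv ℝ X x (stdOrthonormalBasis ℝ E i))⟫ :=
  LinearMap.trace_eq_sum_inner _ (stdOrthonormalBasis ℝ E)

theorem continuous_divAlong {X : E → E} (hX : ContDiff ℝ 1 X) :
    Continuous fun q : E × Gr m E => divAlong q.2 X q.1 := by
  simp_rw [divAlong_eq_sum_stdOrthonormalBasis]
  have hproj : Continuous fun q : E × Gr m E => q.2.proj := Gr.continuous_proj.comp continuous_snd
  have hfderiv : Continuous fun q : E × Gr m E => fderiv ℝ X q.1 :=
    (hX.continuous_fderiv one_ne_zero).comp continuous_fst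
  fun_prop

theorem abs_divAlong_le (S : Gr m E) (X : E → E) (x : E) :
    |divAlong S X x| ≤ Module.finrank ℝ E * ‖fderiv ℝ X x‖ := by
  set b := stdOrthonormalBasis ℝ E
  have hterm (i) : |⟪b i, S.proj (fderiv ℝ X x (b i))⟫| ≤ ‖fderiv ℝ X x‖ :=
    calc |⟪b i, S.proj (fderiv ℝ X x (b i))⟫| ≤ ‖b i‖ * ‖S.proj (fderiv ℝ X x (b i))‖ :=
          abs_real_inner_le_norm _ _
      _ ≤ ‖b i‖ * (1 * (‖fderiv ℝ X x‖ * ‖b i‖)) := by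
          gcongr
          exact (S.proj.le_of_opNorm_le S.norm_proj_le _).trans
            (by gcongr; exact (fderiv ℝ X x).le_opNorm _)
      _ = ‖fderiv ℝ X x‖ := by simp [b.orthonormal.1 i]
  rw [divAlong_eq_sum_stdOrthonormalBasis]
  calc |∑ i, ⟪b i, S.proj (fderiv ℝ X x (b i))⟫| ≤ ∑ _i, ‖fderiv ℝ X x‖ :=
        (Finset.abs_sum_le_sum_abs _ _).trans (Finset.sum_le_sum fun i _ => hterm i)
    _ = _ := by simp

theorem divAlong_of_notMem_tsupport (S : Gr m E) {X : E → E} {x : E} (hx : x ∉ tsupport X) :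
    divAlong S X x = 0 := by
  have hfderiv : fderiv ℝ X x = 0 :=
    Function.notMem_support.1 fun h => hx (support_fderiv_subset ℝ h)
  simp [divAlong, hfderiv]

variable [MeasurableSpace E] [BorelSpace E] {U : Set E} {V : Measure (E × Gr m E)}

theorem IsVarifold.integrable_divAlong (hV : IsVarifold U V) {X : E → E} (hX : ContDiff ℝ 1 X)
    (hc : HasCompactSupport X) (hXU : tsupport X ⊆ U) :
    Integrable (fun q : E × Gr m E => divAlong q.2 X q.1) V := by
  obtain ⟨K, hK⟩ := (hX.continuous_fderiv one_ne_zero).norm.bounded_above_of_compact_support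
    (hc.fderiv ℝ).norm
  rw [← integrableOn_iff_integrable_of_support_subset (s := tsupport X ×ˢ univ)]
  · refine Measure.integrableOn_of_bounded (M := Module.finrank ℝ E * K) (hV.2 _ hXU hc).ne
      (continuous_divAlong hX).measurable.aestronglyMeasurable (Eventually.of_forall fun q => ?_)
    refine (abs_divAlong_le _ _ _).trans ?_
    gcongr
    simpa using hK q.1
  · intro q hq
    by_contra hmem
    exact hq (divAlong_of_notMem_tsupport _ fun h => hmem ⟨h, mem_univ _⟩)

theorem IsVarifold.weight_lt_top (hV : IsVarifold U V) {K : Set E} (hK : IsCompact K)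
    (hKU : K ⊆ U) : weight V K < ⊤ := by
  rw [weight, Measure.map_apply measurable_fst hK.measurableSet, ← prod_univ]
  exact hV.2 K hKU hK

theorem IsStationary.integral_le_zero (hstat : IsStationary U V) (hV : IsVarifold U V) {X : E → E}
    (hX : ContDiff ℝ ∞ X) (hc : HasCompactSupport X) (hXU : tsupport X ⊆ U) {l : E → ℝ}
    (hl : Integrable l (weight V)) (hle : ∀ z, ∀ S : Gr m E, l z ≤ divAlong S X z) :
    ∫ z, l z ∂weight V ≤ 0 := by
  rw [← hstat X hX hc hXU, weight,
    integral_map measurable_fst.aemeasurable hl.aestronglyMeasurable]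
  exact integral_mono (hl.comp_measurable measurable_fst)
    (hV.integrable_divAlong (contDiff_infty.1 hX 1) hc hXU) fun q => hle q.1 q.2

end FirstVariation

section Green

variable {E : Type*} [NormedAddCommGroup E] [InnerProductSpace ℝ E] [FiniteDimensional ℝ E]
  {m : ℕ} {ψ h : E → ℝ} {U : Set E}

/-- The vector field of Green's second identity, `div_S (ψ ∇h - h ∇ψ) = ψ Δ_S h - h Δ_S ψ`. -/
def greenField (ψ h : E → ℝ) (z : E) : E := ψ z • ∇ h z - h z • ∇ ψ z

theorem divAlong_greenField (S : Gr m E) {x : E} (hψ : ContDiffAt ℝ 2 ψ x)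
    (hh : ContDiffAt ℝ 2 h x) :
    divAlong S (greenField ψ h) x = ψ x * laplacianAlong S h x - h x * laplacianAlong S ψ x := by
  have hψ' := hψ.differentiableAt two_ne_zero
  have hh' := hh.differentiableAt two_ne_zero
  have hdψ := differentiableAt_gradient hψ
  have hdh := differentiableAt_gradient hh
  rw [show greenField ψ h = fun z => ψ z • ∇ h z - h z • ∇ ψ z from rfl,
    divAlong_sub S (hψ'.fun_smul hdh) (hh'.fun_smul hdψ), divAlong_smul S hψ' hdh,
    divAlong_smul S hh' hdψ, ← Gr.inner_proj, real_inner_comm, laplacianAlong, laplacianAlong]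
  ring

theorem tsupport_greenField_subset (ψ h : E → ℝ) : tsupport (greenField ψ h) ⊆ tsupport ψ := by
  refine closure_minimal (fun z hz => ?_) (isClosed_tsupport ψ)
  by_contra hzψ
  have hfderiv : fderiv ℝ ψ z = 0 :=
    Function.notMem_support.1 fun h => hzψ (support_fderiv_subset ℝ h)
  exact hz (by simp [greenField, gradient, hfderiv, image_eq_zero_of_notMem_tsupport hzψ])

theorem contDiff_greenField (hU : IsOpen U) (hψ : ContDiff ℝ ∞ ψ) (hh : ContDiffOn ℝ ∞ h U)
    (hψU : tsupport ψ ⊆ U) : ContDiff ℝ ∞ (greenField ψ h) := by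
  rw [contDiff_iff_contDiffAt]
  intro z
  by_cases hz : z ∈ U
  · have hhz : ContDiffAt ℝ ∞ h z := hh.contDiffAt (hU.mem_nhds hz)
    have hψz : ContDiffAt ℝ ∞ ψ z := hψ.contDiffAt
    exact (hψz.smul (contDiffAt_gradient hhz)).sub (hhz.smul (contDiffAt_gradient hψz))
  · have hzero : greenField ψ h =ᶠ[𝓝 z] 0 :=
      notMem_tsupport_iff_eventuallyEq.1 fun h' => hz (hψU (tsupport_greenField_subset ψ h h'))
    exact contDiffAt_const.congr_of_eventuallyEq hzero

end Green

section MeanValue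

variable {E : Type*} [NormedAddCommGroup E] [InnerProductSpace ℝ E] [FiniteDimensional ℝ E]
  {m : ℕ} {U : Set E} {p : E} {ρ σ K : ℝ} {h : E → ℝ}

theorem indicator_sub_indicator_le_divAlong_greenField (hU : IsOpen U) (hρ : 0 < ρ) (hσ : 0 < σ)
    (hσρ : 2 * σ ^ 2 ≤ ρ ^ 2) (hlow : ∀ t, -K ≤ radialCharge m (truncPow m (ρ ^ 2) σ) t)
    (hK : 0 ≤ K) (hpU : Metric.closedBall p ρ ⊆ U) (hh : ContDiffOn ℝ ∞ h U)
    (hnn : ∀ z ∈ Metric.closedBall p ρ, 0 ≤ h z) (S : Gr m E)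
    (hlap : ∀ z ∈ Metric.closedBall p ρ, 0 ≤ laplacianAlong S h z) (z : E) :
    (Metric.closedBall p σ).indicator (fun z => m * 2 ^ (-(m / 4) : ℝ) / σ ^ m * h z) z
        - (Metric.closedBall p ρ).indicator (fun z => K * h z) z
      ≤ divAlong S (greenField (kernel m ρ σ p) h) z := by
  by_cases hz : z ∈ Metric.closedBall p ρ
  · rw [divAlong_greenField S (contDiff_infty.1 (contDiff_kernel m ρ hσ p) 2).contDiffAt
      (contDiffAt_infty.1 (hh.contDiffAt (hU.mem_nhds (hpU hz))) 2), indicator_of_mem hz]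
    have hψ := mul_nonneg (kernel_nonneg (m := m) hρ hσ p z) (hlap z hz)
    have hcharge := mul_le_mul_of_nonneg_left (laplacianAlong_kernel_le hρ hσ S p z) (hnn z hz)
    by_cases hzσ : z ∈ Metric.closedBall p σ
    · have hzσ' : ‖z - p‖ ^ 2 ≤ σ ^ 2 := by
        rw [mem_closedBall_iff_norm] at hzσ
        gcongr
      have hhigh := mul_le_mul_of_nonneg_left
        (le_radialCharge_of_le_sq (m := m) hσ hσρ (sq_nonneg ‖z - p‖) hzσ') (hnn z hz)
      rw [indicator_of_mem hzσ]
      linarith [mul_nonneg hK (hnn z hz)]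
    · have hlow := mul_le_mul_of_nonneg_left (hlow (‖z - p‖ ^ 2)) (hnn z hz)
      rw [indicator_of_notMem hzσ]
      linarith
  · have hzσ : z ∉ Metric.closedBall p σ := fun hzσ =>
      hz (Metric.closedBall_subset_closedBall (by nlinarith) hzσ)
    rw [indicator_of_notMem hz, indicator_of_notMem hzσ, sub_self, divAlong_of_notMem_tsupport]
    exact fun h' => hz (tsupport_kernel_subset hρ p (tsupport_greenField_subset _ _ h'))

variable [MeasurableSpace E] [BorelSpace E] {V : Measure (E × Gr m E)}

theorem IsVarifold.integrableOn_closedBall (hV : IsVarifold U V)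
    (hpU : Metric.closedBall p ρ ⊆ U) (hh : ContinuousOn h U) :
    IntegrableOn h (Metric.closedBall p ρ) (weight V) :=
  (hh.mono hpU).integrableOn_of_subset_isCompact (isCompact_closedBall p ρ)
    Metric.isClosed_closedBall.measurableSet subset_rfl
    (hV.weight_lt_top (isCompact_closedBall p ρ) hpU).ne

theorem IsStationary.mul_setIntegral_closedBall_le (hU : IsOpen U) (hV : IsVarifold U V)
    (hstat : IsStationary U V) (hρ : 0 < ρ) (hσ : 0 < σ) (hσρ : 2 * σ ^ 2 ≤ ρ ^ 2)
    (hlow : ∀ t, -K ≤ radialCharge m (truncPow m (ρ ^ 2) σ) t) (hK : 0 ≤ K)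
    (hpU : Metric.closedBall p ρ ⊆ U) (hh : ContDiffOn ℝ ∞ h U)
    (hnn : ∀ z ∈ Metric.closedBall p ρ, 0 ≤ h z)
    (hlap : ∀ z ∈ Metric.closedBall p ρ, ∀ S : Gr m E, 0 ≤ laplacianAlong S h z) :
    m * 2 ^ (-(m / 4) : ℝ) / σ ^ m * ∫ z in Metric.closedBall p σ, h z ∂weight V
      ≤ K * ∫ z in Metric.closedBall p ρ, h z ∂weight V := by
  have hmeas (r : ℝ) : MeasurableSet (Metric.closedBall p r) :=
    Metric.isClosed_closedBall.measurableSet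
  have hσU : Metric.closedBall p σ ⊆ U :=
    (Metric.closedBall_subset_closedBall (by nlinarith)).trans hpU
  have hintσ := (integrable_indicator_iff (hmeas σ)).2
    ((hV.integrableOn_closedBall hσU hh.continuousOn).const_mul (m * 2 ^ (-(m / 4) : ℝ) / σ ^ m))
  have hintρ := (integrable_indicator_iff (hmeas ρ)).2
    ((hV.integrableOn_closedBall hpU hh.continuousOn).const_mul K)
  have hψρ : tsupport (greenField (kernel m ρ σ p) h) ⊆ Metric.closedBall p ρ :=
    (tsupport_greenField_subset _ _).trans (tsupport_kernel_subset hρ p)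
  have hgreen := hstat.integral_le_zero hV
    (contDiff_greenField hU (contDiff_kernel m ρ hσ p) hh ((tsupport_kernel_subset hρ p).trans hpU))
    ((isCompact_closedBall p ρ).of_isClosed_subset (isClosed_tsupport _) hψρ) (hψρ.trans hpU)
    (hintσ.sub hintρ) fun z S => indicator_sub_indicator_le_divAlong_greenField hU hρ hσ hσρ hlow hK
      hpU hh hnn S (fun z hz => hlap z hz S) z
  rwa [integral_sub' hintσ hintρ, integral_indicator (hmeas σ), integral_indicator (hmeas ρ),
    integral_const_mul, integral_const_mul, sub_nonpos] at hgreen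

theorem exists_setLIntegral_closedBall_le (E : Type*) [NormedAddCommGroup E]
    [InnerProductSpace ℝ E] [FiniteDimensional ℝ E] [MeasurableSpace E] [BorelSpace E]
    (hm : 1 ≤ m) (hρ : 0 < ρ) :
    ∃ K : ℝ≥0, 0 < K ∧ ∀ {U : Set E} {V : Measure (E × Gr m E)}, IsOpen U → IsVarifold U V →
      IsStationary U V → ∀ {p : E}, Metric.closedBall p ρ ⊆ U → ∀ {h : E → ℝ},
      ContDiffOn ℝ ∞ h U → (∀ z ∈ Metric.closedBall p ρ, 0 ≤ h z) →
      (∀ z ∈ Metric.closedBall p ρ, ∀ S : Gr m E, 0 ≤ laplacianAlong S h z) →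
      ∀ σ : ℝ, 0 < σ → 2 * σ ^ 2 ≤ ρ ^ 2 →
        ∫⁻ z in Metric.closedBall p σ, ENNReal.ofReal (h z) ∂weight V
          ≤ K * ENNReal.ofReal σ ^ m *
            ∫⁻ z in Metric.closedBall p ρ, ENNReal.ofReal (h z) ∂weight V := by
  obtain ⟨K, hK, hlow⟩ := exists_neg_le_radialCharge m (R := ρ ^ 2) (by positivity)
  set c : ℝ := m * 2 ^ (-(m / 4) : ℝ) with hc
  have hc0 : 0 < c := by positivity
  have hKc : 0 < K / c := by positivity
  refine ⟨(K / c).toNNReal, Real.toNNReal_pos.2 hKc, ?_⟩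
  intro U V hU hV hstat p hpU h hh hnn hlap σ hσ hσρ
  have hreal :=
    hstat.mul_setIntegral_closedBall_le hU hV hρ hσ hσρ (hlow σ hσ) hK.le hpU hh hnn hlap
  have hofReal {r : ℝ} (hr : r ≤ ρ) :
      ∫⁻ z in Metric.closedBall p r, ENNReal.ofReal (h z) ∂weight V
        = ENNReal.ofReal (∫ z in Metric.closedBall p r, h z ∂weight V) := by
    have hrρ : Metric.closedBall p r ⊆ Metric.closedBall p ρ :=
      Metric.closedBall_subset_closedBall hr
    refine (ofReal_integral_eq_lintegral_ofReal
      (hV.integrableOn_closedBall (hrρ.trans hpU) hh.continuousOn) ?_).symm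
    exact ae_restrict_of_forall_mem Metric.isClosed_closedBall.measurableSet
      fun z hz => hnn z (hrρ hz)
  rw [hofReal (by nlinarith), hofReal le_rfl,
    ← ENNReal.ofReal,
    ← ENNReal.ofReal_pow hσ.le, ← ENNReal.ofReal_mul hKc.le, ← ENNReal.ofReal_mul (by positivity)]
  refine ENNReal.ofReal_le_ofReal ?_
  rw [← hc, div_mul_eq_mul_div, div_le_iff₀ (by positivity)] at hreal
  rw [div_mul_eq_mul_div, div_mul_eq_mul_div, le_div_iff₀ hc0]
  linarith

end MeanValue

section Density

variable {E : Type*} {m : ℕ}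

/-- The `m`-dimensional lower density of `μ` at `x` is at least `θ`, in the strong sense that small
closed balls already have at least the corresponding mass; no volume normalization is made. -/
def HasLowerDensity [PseudoMetricSpace E] [MeasurableSpace E] (μ : Measure E) (m : ℕ) (θ : ℝ≥0)
    (x : E) : Prop :=
  ∀ᶠ r in 𝓝[>] (0 : ℝ), θ * ENNReal.ofReal r ^ m ≤ μ (Metric.closedBall x r)

theorem HasLowerDensity.mul_le [PseudoMetricSpace E] [MeasurableSpace E] [OpensMeasurableSpace E]
    {μ : Measure E} {θ : ℝ≥0} {p : E} {f : E → ℝ≥0∞} {A : ℝ≥0∞} (hθ : HasLowerDensity μ m θ p)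
    (hf : ContinuousAt f p)
    (hA : ∀ᶠ r in 𝓝[>] (0 : ℝ), ∫⁻ z in Metric.closedBall p r, f z ∂μ ≤ A * ENNReal.ofReal r ^ m) :
    f p * θ ≤ A := by
  have hlt (a : ℝ≥0∞) (ha : a < f p) : a * θ ≤ A := by
    obtain ⟨ε, hε, hball⟩ := Metric.eventually_nhds_iff_ball.1 (hf.eventually (lt_mem_nhds ha))
    have hsmall : ∀ᶠ r in 𝓝[>] (0 : ℝ), r < ε := nhdsWithin_le_nhds (gt_mem_nhds hε)
    obtain ⟨r, hr0, hrε, hrθ, hrA⟩ :=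
      (eventually_mem_nhdsWithin.and (hsmall.and (hθ.and hA))).exists
    have hrm : ENNReal.ofReal r ^ m ≠ 0 := pow_ne_zero _ (ENNReal.ofReal_pos.2 hr0).ne'
    refine (ENNReal.mul_le_mul_iff_left hrm (ENNReal.pow_ne_top ENNReal.ofReal_ne_top)).1 ?_
    calc a * θ * ENNReal.ofReal r ^ m
        ≤ a * μ (Metric.closedBall p r) := by rw [mul_assoc]; gcongr
      _ = ∫⁻ _ in Metric.closedBall p r, a ∂μ := (setLIntegral_const _ _).symm
      _ ≤ ∫⁻ z in Metric.closedBall p r, f z ∂μ :=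
          setLIntegral_mono' Metric.isClosed_closedBall.measurableSet fun z hz =>
            (hball z (Metric.closedBall_subset_ball hrε hz)).le
      _ ≤ A * ENNReal.ofReal r ^ m := hrA
  rcases eq_or_ne θ 0 with rfl | hθ0
  · simp
  have hθ0' : (θ : ℝ≥0∞) ≠ 0 := ENNReal.coe_ne_zero.2 hθ0
  rw [← ENNReal.le_div_iff_mul_le (.inl hθ0') (.inl ENNReal.coe_ne_top)]
  exact le_of_forall_lt_imp_le_of_dense fun a ha =>
    (ENNReal.le_div_iff_mul_le (.inl hθ0') (.inl ENNReal.coe_ne_top)).2 (hlt a ha)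

/-- The integral over an `m`-plane of the standard radial hat function. -/
def hatIntegral (m : ℕ) : ℝ := ∫ x : EuclideanSpace ℝ (Fin m), max 0 (1 - ‖x‖)

theorem hasCompactSupport_hat (F : Type*) [NormedAddCommGroup F] [ProperSpace F] :
    HasCompactSupport fun x : F => max 0 (1 - ‖x‖) := by
  refine HasCompactSupport.of_support_subset_isCompact (isCompact_closedBall (0 : F) 1) ?_
  intro x hx
  rw [mem_closedBall_zero_iff]
  by_contra h
  exact hx (max_eq_left (by linarith))

theorem hatIntegral_pos (m : ℕ) : 0 < hatIntegral m := by
  have hcont : Continuous fun x : EuclideanSpace ℝ (Fin m) => max 0 (1 - ‖x‖) := by fun_prop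
  exact hcont.integral_pos_of_hasCompactSupport_nonneg_nonzero (hasCompactSupport_hat _)
    (fun _ => le_max_left _ _) (x := 0) (by simp)

variable [NormedAddCommGroup E] [MeasurableSpace E] [BorelSpace E]

theorem integral_hat_smul_le [NormedSpace ℝ E] (μ : Measure E) (x : E) {r : ℝ} (hr : 0 < r) :
    ENNReal.ofReal (∫ y, max 0 (1 - ‖r⁻¹ • (y - x)‖) ∂μ) ≤ μ (Metric.closedBall x r) := by
  have hle (y : E) : ENNReal.ofReal (max 0 (1 - ‖r⁻¹ • (y - x)‖))
      ≤ (Metric.closedBall x r).indicator 1 y := by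
    rw [norm_smul, norm_inv, Real.norm_of_nonneg hr.le, inv_mul_eq_div]
    by_cases hy : y ∈ Metric.closedBall x r
    · rw [indicator_of_mem hy]
      exact ENNReal.ofReal_le_one.2 (max_le zero_le_one (sub_le_self _ (by positivity)))
    · rw [indicator_of_notMem hy, nonpos_iff_eq_zero, ENNReal.ofReal_eq_zero]
      rw [mem_closedBall_iff_norm, not_le] at hy
      exact max_le le_rfl (sub_nonpos.2 ((one_le_div hr).2 hy.le))
  by_cases hint : Integrable (fun y => max 0 (1 - ‖r⁻¹ • (y - x)‖)) μ
  · rw [ofReal_integral_eq_lintegral_ofReal hint (Eventually.of_forall fun _ => le_max_left _ _),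
      ← lintegral_indicator_one Metric.isClosed_closedBall.measurableSet]
    exact lintegral_mono hle
  · simp [integral_undef hint]

variable [InnerProductSpace ℝ E] [FiniteDimensional ℝ E]

theorem setIntegral_hat (S : Gr m E) :
    ∫ y in (S.1 : Set E), max 0 (1 - ‖y‖) ∂μHE[m] = hatIntegral m := by
  set e := ((stdOrthonormalBasis ℝ S.1).reindex (finCongr S.2)).repr.symm
  set f : EuclideanSpace ℝ (Fin m) →ₗᵢ[ℝ] E := S.1.subtypeₗᵢ.comp e.toLinearIsometry with hf
  have hrange : range f = (S.1 : Set E) := by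
    rw [hf, LinearIsometry.coe_comp, LinearIsometryEquiv.coe_toLinearIsometry,
      e.surjective.range_comp]
    exact Subtype.range_coe
  rw [← hrange, ← f.isometry.map_euclideanHausdorffMeasure,
    EuclideanSpace.euclideanHausdorffMeasure_eq_volume,
    integral_map f.continuous.measurable.aemeasurable (by fun_prop)]
  simp only [f.norm_map, hatIntegral]

theorem IsApproxTangent.hasLowerDensity {A : Set E} {x : E} {S : Gr m E}
    (h : IsApproxTangent A x S) :
    HasLowerDensity ((μHE[m] : Measure E).restrict A) m (hatIntegral m / 2).toNNReal x := by
  have hlim := h (fun y => max 0 (1 - ‖y‖)) (by fun_prop) (hasCompactSupport_hat E)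
  rw [setIntegral_hat] at hlim
  have hpos := hatIntegral_pos m
  filter_upwards [hlim.eventually (lt_mem_nhds (half_lt_self hpos)), self_mem_nhdsWithin]
    with r hr hr0
  have hr0 : 0 < r := hr0
  rw [inv_mul_eq_div, lt_div_iff₀ (by positivity)] at hr
  rw [← ENNReal.ofReal, ← ENNReal.ofReal_pow hr0.le, ← ENNReal.ofReal_mul (by positivity)]
  exact (ENNReal.ofReal_le_ofReal hr.le).trans (integral_hat_smul_le _ x hr0)

theorem IsIntegralVarifold.ae_hasLowerDensity {U : Set E} {V : Measure (E × Gr m E)}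
    (hV : IsIntegralVarifold U V) :
    ∀ᵐ x ∂weight V, HasLowerDensity (weight V) m (hatIntegral m / 2).toNNReal x := by
  obtain ⟨-, A, Θ, T, -, -, -, -, hΘ, hweight, -, hT, -⟩ := hV
  have hle : (μHE[m] : Measure E).restrict A ≤ weight V := by
    rw [hweight]
    nth_rw 1 [← withDensity_one (μ := (μHE[m] : Measure E).restrict A)]
    exact withDensity_mono (hΘ.mono fun y hy => Nat.one_le_cast.2 hy)
  filter_upwards [hT] with x hx
  exact hx.hasLowerDensity.mono fun r hr => hr.trans (hle _)

end Density

section Straightening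

theorem injective_of_hasFDerivAt_leftInverse {F G : Type*} [NormedAddCommGroup F]
    [NormedSpace ℝ F] [NormedAddCommGroup G] [NormedSpace ℝ G] {Φ : F → G} {Ψ : G → F} {p : F}
    {A : F →L[ℝ] G} {B : G →L[ℝ] F} (hΦ : HasFDerivAt Φ A p) (hΨ : HasFDerivAt Ψ B (Φ p))
    (h : ∀ᶠ z in 𝓝 p, Ψ (Φ z) = z) : Function.Injective A := by
  have hcomp : B ∘L A = ContinuousLinearMap.id ℝ F :=
    (hΨ.comp p hΦ).unique ((hasFDerivAt_id p).congr_of_eventuallyEq h)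
  exact Function.LeftInverse.injective (g := B) (DFunLike.congr_fun hcomp)

theorem injective_snd_comp_inr {K X Y : Type*} [DivisionRing K] [AddCommGroup X] [Module K X]
    [AddCommGroup Y] [Module K Y] [FiniteDimensional K X] {A : X × Y →ₗ[K] X × Y}
    (hA : Function.Injective A) {L : X →ₗ[K] Y} (hL : ∀ a, (A (a, L a)).2 = 0) :
    Function.Injective (.snd K X Y ∘ₗ A ∘ₗ .inr K X Y) := by
  have hgraph : Function.Injective (.fst K X Y ∘ₗ A ∘ₗ LinearMap.id.prod L) := fun a b hab =>
    congrArg Prod.fst (hA (Prod.ext hab ((hL a).trans (hL b).symm)))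
  rw [injective_iff_map_eq_zero]
  intro b hb
  obtain ⟨a, ha⟩ := LinearMap.injective_iff_surjective.1 hgraph (A (0, b)).1
  have hab : (a, L a) = ((0 : X), b) := hA (Prod.ext ha ((hL a).trans hb.symm))
  obtain ⟨rfl, rfl⟩ := Prod.mk.inj hab
  exact map_zero L

variable {X Y : Type*} [NormedAddCommGroup X] [NormedSpace ℝ X] [NormedAddCommGroup Y]
  [NormedSpace ℝ Y] {g : X → Y} {x : X} {k : WithTop ℕ∞}

theorem contDiffAt_of_eventually_apply_eq [CompleteSpace X] [CompleteSpace Y] {Z : Type*}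
    [NormedAddCommGroup Z] [NormedSpace ℝ Z] [CompleteSpace Z] {f : X × Y → Z}
    (hf : ContDiffAt ℝ k f (x, g x)) (hk : k ≠ 0)
    (hinv : (fderiv ℝ f (x, g x) ∘L .inr ℝ X Y).IsInvertible) (hg : ContinuousAt g x)
    (heq : ∀ᶠ y in 𝓝 x, f (y, g y) = f (x, g x)) : ContDiffAt ℝ k g x := by
  refine (hf.contDiffAt_implicitFunction hk hinv).congr_of_eventuallyEq ?_
  filter_upwards [(continuousAt_id.prodMk hg).eventually
    (hf.eventually_apply_eq_iff_implicitFunction hk hinv), heq] with y hiff hy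
  exact (hiff.1 hy).symm

theorem contDiffAt_of_straightened_graph [FiniteDimensional ℝ X] [FiniteDimensional ℝ Y]
    {Φ Ψ : X × Y → X × Y} (hΦ : ContDiffAt ℝ k Φ (x, g x)) (hk : k ≠ 0)
    (hΨ : DifferentiableAt ℝ Ψ (Φ (x, g x))) (hinv : ∀ᶠ q in 𝓝 (x, g x), Ψ (Φ q) = q)
    (hg : DifferentiableAt ℝ g x) (hzero : ∀ᶠ y in 𝓝 x, (Φ (y, g y)).2 = 0) :
    ContDiffAt ℝ k g x := by
  have : CompleteSpace X := FiniteDimensional.complete ℝ X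
  have : CompleteSpace Y := FiniteDimensional.complete ℝ Y
  set A := fderiv ℝ Φ (x, g x)
  have hA : HasFDerivAt Φ A (x, g x) := (hΦ.differentiableAt hk).hasFDerivAt
  have hAinj : Function.Injective A := injective_of_hasFDerivAt_leftInverse hA hΨ.hasFDerivAt hinv
  have hgraph : HasFDerivAt (fun y => (Φ (y, g y)).2)
      (.snd ℝ X Y ∘L A ∘L (ContinuousLinearMap.id ℝ X).prod (fderiv ℝ g x)) x :=
    (hA.comp x ((hasFDerivAt_id x).prodMk hg.hasFDerivAt)).snd
  have hgraph0 : .snd ℝ X Y ∘L A ∘L (ContinuousLinearMap.id ℝ X).prod (fderiv ℝ g x) = 0 :=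
    hgraph.unique ((hasFDerivAt_const 0 x).congr_of_eventuallyEq hzero)
  have hvert : Function.Injective (.snd ℝ X Y ∘ₗ (A : X × Y →ₗ[ℝ] X × Y) ∘ₗ .inr ℝ X Y) :=
    injective_snd_comp_inr hAinj (L := fderiv ℝ g x) (DFunLike.congr_fun hgraph0)
  refine contDiffAt_of_eventually_apply_eq (f := fun q => (Φ q).2) hΦ.snd hk ?_ hg.continuousAt
    (hzero.mono fun y hy => hy.trans hzero.self_of_nhds.symm)
  rw [hA.snd.fderiv]
  exact ⟨(LinearEquiv.ofInjectiveEndo _ hvert).toContinuousLinearEquiv, rfl⟩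

end Straightening

section Graph

section

variable {X Y : Type*} {M : Set (WithLp 2 (X × Y))} {g : X → Y} {U : Set X} {x : X}
  {v w : WithLp 2 (X × Y)}

theorem ext_fst_snd (hfst : v.fst = w.fst) (hsnd : v.snd = w.snd) : v = w :=
  WithLp.ofLp_injective 2 (Prod.ext hfst hsnd)

/-- Over `U`, the set `M` is the graph of `g`. -/
def IsGraphOver (M : Set (WithLp 2 (X × Y))) (g : X → Y) (U : Set X) : Prop :=
  ∀ ⦃z : WithLp 2 (X × Y)⦄, z.fst ∈ U → (z ∈ M ↔ z.snd = g z.fst)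

/-- The parametrization `x ↦ (x, g x)` of the graph of `g`. -/
def graphMap (g : X → Y) (x : X) : WithLp 2 (X × Y) := WithLp.toLp 2 (x, g x)

theorem IsGraphOver.graphMap_mem (hM : IsGraphOver M g U) (hx : x ∈ U) : graphMap g x ∈ M :=
  (hM (z := graphMap g x) hx).2 rfl

theorem IsGraphOver.eq_graphMap (hM : IsGraphOver M g U) (hv : v ∈ M) (hvU : v.fst ∈ U) :
    v = graphMap g v.fst :=
  ext_fst_snd rfl ((hM hvU).1 hv)

end

variable {X Y : Type*} [NormedAddCommGroup X] [InnerProductSpace ℝ X] [NormedAddCommGroup Y]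
  [InnerProductSpace ℝ Y]

/-- The parametrization `a ↦ (a, L a)` of the graph of a linear map, as a linear map. -/
def graphL (L : X →L[ℝ] Y) : X →L[ℝ] WithLp 2 (X × Y) :=
  (WithLp.prodContinuousLinearEquiv 2 ℝ X Y).symm ∘L (ContinuousLinearMap.id ℝ X).prod L

/-- The inclusion `y ↦ (0, y)` of the second factor. -/
def verticalL (X Y : Type*) [NormedAddCommGroup X] [InnerProductSpace ℝ X] [NormedAddCommGroup Y]
    [InnerProductSpace ℝ Y] : Y →L[ℝ] WithLp 2 (X × Y) :=
  (WithLp.prodContinuousLinearEquiv 2 ℝ X Y).symm ∘L .inr ℝ X Y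

/-- The graph of a linear map, as a linear subspace. -/
def graphPlane (L : X →L[ℝ] Y) : Submodule ℝ (WithLp 2 (X × Y)) := (graphL L).range

variable {M : Set (WithLp 2 (X × Y))} {g : X → Y} {g' L : X →L[ℝ] Y} {U : Set X} {x : X}
  {v w : WithLp 2 (X × Y)}

theorem mem_graphPlane : v ∈ graphPlane L ↔ v.snd = L v.fst :=
  ⟨by rintro ⟨a, rfl⟩; rfl, fun h => ⟨v.fst, ext_fst_snd rfl h.symm⟩⟩

theorem finrank_graphPlane (L : X →L[ℝ] Y) :
    Module.finrank ℝ (graphPlane L) = Module.finrank ℝ X :=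
  LinearMap.finrank_range_of_inj fun _ _ h => congrArg (·.fst) h

theorem eq_graphL_add_verticalL (L : X →L[ℝ] Y) (v : WithLp 2 (X × Y)) :
    v = graphL L v.fst + verticalL X Y (v.snd - L v.fst) :=
  ext_fst_snd (add_zero v.fst).symm (add_sub_cancel (L v.fst) v.snd).symm

theorem hasFDerivAt_graphMap (hg : HasFDerivAt g g' x) : HasFDerivAt (graphMap g) (graphL g') x :=
  (WithLp.prodContinuousLinearEquiv 2 ℝ X Y).symm.hasFDerivAt.comp x
    ((hasFDerivAt_id x).prodMk hg)

theorem preimage_fst_mem_nhds (hU : U ∈ 𝓝 v.fst) : {z | z.fst ∈ U} ∈ 𝓝 v :=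
  (WithLp.fstL 2 ℝ X Y).continuous.continuousAt hU

theorem tangentPlane_eq_graphPlane (hM : IsGraphOver M g U) (hU : U ∈ 𝓝 x)
    (hg : HasFDerivAt g g' x) : tangentPlane M (graphMap g x) = graphPlane g' := by
  refine le_antisymm (Submodule.span_le.2 fun v hv => ?_) ?_
  · have hF : HasFDerivAt (fun z : WithLp 2 (X × Y) => z.snd - g z.fst)
        (WithLp.sndL 2 ℝ X Y - g' ∘L WithLp.fstL 2 ℝ X Y) (graphMap g x) :=
      (WithLp.sndL 2 ℝ X Y).hasFDerivAt.sub (HasFDerivAt.comp (f := WithLp.fst) (graphMap g x) hg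
        (WithLp.fstL 2 ℝ X Y).hasFDerivAt)
    have hF0 : (fun z : WithLp 2 (X × Y) => z.snd - g z.fst) '' (M ∩ {z | z.fst ∈ U}) ⊆ {0} := by
      rintro _ ⟨z, ⟨hz, hzU⟩, rfl⟩
      exact sub_eq_zero.2 ((hM hzU).1 hz)
    rw [← tangentConeAt_inter_nhds (preimage_fst_mem_nhds (v := graphMap g x) hU)] at hv
    have hv0 := tangentConeAt_mono hF0 (hF.hasFDerivWithinAt.mapsTo_tangent_cone hv)
    have hacc : ¬AccPt ((graphMap g x).snd - g (graphMap g x).fst) (𝓟 ({0} : Set Y)) :=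
      fun h => Set.Infinite.of_accPt h (finite_singleton 0)
    exact mem_graphPlane.2 (sub_eq_zero.1 (tangentConeAt_subset_zero hacc hv0))
  · rintro _ ⟨a, rfl⟩
    have ha : a ∈ tangentConeAt ℝ U x := tangentConeAt_of_mem_nhds (𝕜 := ℝ) hU ▸ mem_univ a
    refine Submodule.subset_span (tangentConeAt_mono ?_
      ((hasFDerivAt_graphMap hg).hasFDerivWithinAt.mapsTo_tangent_cone ha))
    exact image_subset_iff.2 fun y hy => hM.graphMap_mem hy

theorem eventually_tangentPlane_eq_graphPlane (hM : IsGraphOver M g U) (hU : U ∈ 𝓝 x)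
    (hg : ContDiffAt ℝ 2 g x) :
    ∀ᶠ y in 𝓝 x, tangentPlane M (graphMap g y) = graphPlane (fderiv ℝ g y) := by
  filter_upwards [hg.eventually (by simp), eventually_mem_nhds_iff.2 hU] with y hy hyU
  exact tangentPlane_eq_graphPlane hM hyU (hy.differentiableAt two_ne_zero).hasFDerivAt

variable [FiniteDimensional ℝ X] [FiniteDimensional ℝ Y]

theorem starProjection_graphPlane_orthogonal (L : X →L[ℝ] Y) (v : WithLp 2 (X × Y)) :
    (graphPlane L)ᗮ.starProjection v
      = (graphPlane L)ᗮ.starProjection (verticalL X Y (v.snd - L v.fst)) := by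
  have hgraph : (graphPlane L)ᗮ.starProjection (graphL L v.fst) = 0 :=
    Submodule.starProjection_orthogonal_apply_eq_zero ⟨v.fst, rfl⟩
  conv_lhs => rw [eq_graphL_add_verticalL L v, map_add, hgraph, zero_add]

theorem norm_starProjection_graphPlane_orthogonal_le (L : X →L[ℝ] Y) (v : WithLp 2 (X × Y)) :
    ‖(graphPlane L)ᗮ.starProjection v‖ ≤ ‖v.snd - L v.fst‖ := by
  rw [starProjection_graphPlane_orthogonal]
  exact (Submodule.norm_starProjection_apply_le _ _).trans_eq (WithLp.norm_toLp_snd 2 X Y _)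

theorem norm_le_mul_norm_starProjection_verticalL (L : X →L[ℝ] Y) (b : Y) :
    ‖b‖ ≤ (1 + ‖L‖) * ‖(graphPlane L)ᗮ.starProjection (verticalL X Y b)‖ := by
  set w := (graphPlane L).starProjection (verticalL X Y b)
  set w' := (graphPlane L)ᗮ.starProjection (verticalL X Y b)
  have hsum : w + w' = verticalL X Y b := Submodule.starProjection_add_starProjection_orthogonal _
  have hw : w.snd = L w.fst := mem_graphPlane.1 (Submodule.starProjection_apply_mem _ _)
  have hfst : w.fst = -w'.fst := eq_neg_of_add_eq_zero_left (congrArg (·.fst) hsum)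
  have hsnd : w.snd + w'.snd = b := congrArg (·.snd) hsum
  calc ‖b‖ = ‖w'.snd - L w'.fst‖ := by rw [← hsnd, hw, hfst, map_neg, neg_add_eq_sub]
    _ ≤ ‖w'.snd‖ + ‖L‖ * ‖w'.fst‖ := (norm_sub_le _ _).trans (by gcongr; exact L.le_opNorm _)
    _ ≤ ‖w'‖ + ‖L‖ * ‖w'‖ := by
        gcongr
        · exact WithLp.norm_snd_le _ w'
        · exact WithLp.norm_fst_le _ w'
    _ = (1 + ‖L‖) * ‖w'‖ := by ring

theorem IsGraphOver.contDiffAt_of_straightening {k : WithTop ℕ∞}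
    {Φ : OpenPartialHomeomorph (WithLp 2 (X × Y)) (WithLp 2 (X × Y))}
    (hM : IsGraphOver M g U) (hU : U ∈ 𝓝 x) (hg : DifferentiableAt ℝ g x) (hk : k ≠ 0)
    (hp : graphMap g x ∈ Φ.source) (hΦ : ContDiffOn ℝ k Φ Φ.source)
    (hΦs : ContDiffOn ℝ k Φ.symm Φ.target) (hΦM : ∀ z ∈ Φ.source, z ∈ M ↔ (Φ z).snd = 0) :
    ContDiffAt ℝ k g x := by
  let ι := WithLp.prodContinuousLinearEquiv 2 ℝ X Y
  have hΦp : ContDiffAt ℝ k (ι ∘ Φ ∘ ι.symm) (x, g x) :=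
    ι.contDiff.contDiffAt.comp _
      ((hΦ.contDiffAt (Φ.open_source.mem_nhds hp)).comp (x, g x) ι.symm.contDiff.contDiffAt)
  have hΦsp := hΦs.contDiffAt (Φ.open_target.mem_nhds (Φ.map_source hp))
  refine contDiffAt_of_straightened_graph (Ψ := ι ∘ Φ.symm ∘ ι.symm) hΦp hk ?_ ?_ hg ?_
  · rw [ι.comp_differentiableAt_iff, ι.symm.comp_right_differentiableAt_iff, Function.comp_apply,
      ι.symm_apply_apply]
    exact hΦsp.differentiableAt hk
  · filter_upwards [ι.symm.continuous.continuousAt.eventually (Φ.eventually_left_inverse hp)]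
      with q hq
    simp only [Function.comp_apply, ContinuousLinearEquiv.symm_apply_apply, hq,
      ContinuousLinearEquiv.apply_symm_apply]
  · have hγ := (hasFDerivAt_graphMap hg.hasFDerivAt).continuousAt
    filter_upwards [hγ.eventually (Φ.open_source.mem_nhds hp), hU] with y hy hyU
    exact (hΦM _ hy).1 (hM.graphMap_mem hyU)

theorem IsSmoothSubmanifold.contDiffAt {m n : ℕ} {M : Set (Space m n)}
    {g : EuclideanSpace ℝ (Fin m) → EuclideanSpace ℝ (Fin n)} {U : Set (EuclideanSpace ℝ (Fin m))}
    {x : EuclideanSpace ℝ (Fin m)} (hM : IsSmoothSubmanifold M) (hMg : IsGraphOver M g U)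
    (hU : U ∈ 𝓝 x) (hg : DifferentiableAt ℝ g x) : ContDiffAt ℝ ∞ g x := by
  obtain ⟨Φ, hp, hΦ, hΦs, hΦM⟩ := hM _ (hMg.graphMap_mem (mem_of_mem_nhds hU))
  exact hMg.contDiffAt_of_straightening hU hg (by simp) hp hΦ hΦs hΦM

end Graph

section Curvature

variable {X Y : Type*} [NormedAddCommGroup X] [InnerProductSpace ℝ X] [NormedAddCommGroup Y]
  [InnerProductSpace ℝ Y] {M : Set (WithLp 2 (X × Y))} {g : X → Y} {U : Set X} {x : X}
  {v w : WithLp 2 (X × Y)} {W : WithLp 2 (X × Y) → WithLp 2 (X × Y)}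

theorem exists_isTangentExtension_graphMap (hM : IsGraphOver M g U) (hU : U ∈ 𝓝 x)
    (hg : ContDiffAt ℝ 2 g x) (hw : w ∈ tangentPlane M (graphMap g x)) :
    ∃ W, IsTangentExtension M (graphMap g x) w W := by
  have htangent := eventually_tangentPlane_eq_graphPlane hM hU hg
  have hDg : ContDiffAt ℝ 1 (fderiv ℝ g) x := hg.fderiv_right one_add_one_eq_two.le
  have hDg' : ContDiffAt ℝ 1 (fun z : WithLp 2 (X × Y) => fderiv ℝ g z.fst) (graphMap g x) :=
    ContDiffAt.comp (f := WithLp.fst) (graphMap g x) hDg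
      (WithLp.fstL 2 ℝ X Y).contDiff.contDiffAt
  refine ⟨fun z => graphL (fderiv ℝ g z.fst) w.fst, ?_, ?_, ?_⟩
  · exact (WithLp.prodContinuousLinearEquiv 2 ℝ X Y).symm.contDiff.contDiffAt.comp _
      (contDiffAt_const.prodMk (hDg'.clm_apply contDiffAt_const))
  · rw [htangent.self_of_nhds, mem_graphPlane] at hw
    exact ext_fst_snd rfl hw.symm
  · have hnear := preimage_fst_mem_nhds (v := graphMap g x) (inter_mem hU htangent)
    filter_upwards [self_mem_nhdsWithin, nhdsWithin_le_nhds hnear] with z hz ⟨hzU, hzT⟩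
    rw [hM.eq_graphMap hz hzU]
    exact hzT.symm ▸ ⟨w.fst, rfl⟩

theorem IsTangentExtension.snd_fderiv_sub (hM : IsGraphOver M g U) (hU : U ∈ 𝓝 x)
    (hg : ContDiffAt ℝ 2 g x) (hW : IsTangentExtension M (graphMap g x) w W)
    (hv : v ∈ tangentPlane M (graphMap g x)) :
    (fderiv ℝ W (graphMap g x) v).snd - fderiv ℝ g x (fderiv ℝ W (graphMap g x) v).fst
      = fderiv ℝ (fderiv ℝ g) x v.fst w.fst := by
  obtain ⟨hWd, hWw, hWM⟩ := hW
  have htangent := eventually_tangentPlane_eq_graphPlane hM hU hg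
  have hγ := hasFDerivAt_graphMap (hg.differentiableAt two_ne_zero).hasFDerivAt
  have hDg : HasFDerivAt (fderiv ℝ g) (fderiv ℝ (fderiv ℝ g) x) x :=
    ((hg.fderiv_right one_add_one_eq_two.le).differentiableAt one_ne_zero).hasFDerivAt
  have hγM : Tendsto (graphMap g) (𝓝 x) (𝓝[M] (graphMap g x)) :=
    tendsto_nhdsWithin_iff.2 ⟨hγ.continuousAt, mem_of_superset hU fun y => hM.graphMap_mem⟩
  have hWγ := (hWd.differentiableAt one_ne_zero).hasFDerivAt.comp x hγ
  have hfst := (WithLp.fstL 2 ℝ X Y).hasFDerivAt.comp x hWγ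
  have hsnd := (WithLp.sndL 2 ℝ X Y).hasFDerivAt.comp x hWγ
  -- tangency of `W` along the graph: `W_Y (y, g y) = Dg(y) W_X (y, g y)`
  have heq : ∀ᶠ y in 𝓝 x,
      (W (graphMap g y)).snd = fderiv ℝ g y (W (graphMap g y)).fst := by
    filter_upwards [hγM.eventually hWM, htangent] with y hy hyT
    rwa [hyT, mem_graphPlane] at hy
  have hderiv := hsnd.unique ((hDg.clm_apply hfst).congr_of_eventuallyEq heq)
  have hv' : graphL (fderiv ℝ g x) v.fst = v := by
    rw [htangent.self_of_nhds, mem_graphPlane] at hv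
    exact ext_fst_snd rfl hv.symm
  have happly := DFunLike.congr_fun hderiv v.fst
  simp only [ContinuousLinearMap.comp_apply, _root_.add_apply, hv',
    ContinuousLinearMap.flip_apply, Function.comp_apply, hWw] at happly
  exact sub_eq_of_eq_add' happly

variable [FiniteDimensional ℝ X] [FiniteDimensional ℝ Y]

theorem secondFundamentalForm_graphMap (hM : IsGraphOver M g U) (hU : U ∈ 𝓝 x)
    (hg : ContDiffAt ℝ 2 g x) (hv : v ∈ tangentPlane M (graphMap g x))
    (hw : w ∈ tangentPlane M (graphMap g x)) :
    secondFundamentalForm M (graphMap g x) v w = (tangentPlane M (graphMap g x))ᗮ.starProjection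
      (verticalL X Y (fderiv ℝ (fderiv ℝ g) x v.fst w.fst)) := by
  have hex := exists_isTangentExtension_graphMap hM hU hg hw
  rw [secondFundamentalForm, dif_pos hex]
  simp only [(eventually_tangentPlane_eq_graphPlane hM hU hg).self_of_nhds]
  rw [starProjection_graphPlane_orthogonal, hex.choose_spec.snd_fderiv_sub hM hU hg hv]

theorem norm_sum_fderiv_fderiv_le_meanCurvature (hM : IsGraphOver M g U) (hU : U ∈ 𝓝 x)
    (hg : ContDiffAt ℝ 2 g x) :
    ‖∑ i, fderiv ℝ (fderiv ℝ g) x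
        (stdOrthonormalBasis ℝ (tangentPlane M (graphMap g x)) i : WithLp 2 (X × Y)).fst
        (stdOrthonormalBasis ℝ (tangentPlane M (graphMap g x)) i : WithLp 2 (X × Y)).fst‖
      ≤ (1 + ‖fderiv ℝ g x‖) * ‖meanCurvature M (graphMap g x)‖ := by
  refine (norm_le_mul_norm_starProjection_verticalL (fderiv ℝ g x) _).trans_eq ?_
  simp only [← (eventually_tangentPlane_eq_graphPlane hM hU hg).self_of_nhds, map_sum]
  rw [meanCurvature]
  simp_rw [secondFundamentalForm_graphMap hM hU hg (Subtype.coe_prop _) (Subtype.coe_prop _)]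

theorem two_mul_mul_sqrt_le {N D : ℝ} (hN : 0 ≤ N) (hD : 0 ≤ D) (c : ℝ) :
    2 * (c * √(N * (2 * D))) ≤ 2 * N * c ^ 2 + D :=
  calc 2 * (c * √(N * (2 * D))) = 2 * (c * √(2 * N)) * √D := by
        rw [show N * (2 * D) = 2 * N * D by ring, Real.sqrt_mul (by positivity)]
        ring
    _ ≤ (c * √(2 * N)) ^ 2 + √D ^ 2 := two_mul_le_add_sq _ _
    _ = 2 * N * c ^ 2 + D := by
        rw [mul_pow, Real.sq_sqrt (by positivity), Real.sq_sqrt hD]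
        ring

theorem two_mul_sum_bilin_le {E κ κ' : Type*} [NormedAddCommGroup E] [InnerProductSpace ℝ E]
    [FiniteDimensional ℝ E] [Fintype κ] [Fintype κ'] {B : E →L[ℝ] E →L[ℝ] ℝ} {S T : Submodule ℝ E}
    (e : OrthonormalBasis κ ℝ S) (e' : OrthonormalBasis κ' ℝ T)
    (hcard : Fintype.card κ = Fintype.card κ') {c D : ℝ} (hB : ‖B‖ ≤ c)
    (hD : ∑ j, ‖Tᗮ.starProjection (e j : E)‖ ^ 2 ≤ D) :
    2 * ∑ j, B (e j) (e j)
      ≤ 2 * ∑ j, B (e' j) (e' j) + 2 * Module.finrank ℝ E * c ^ 2 + D := by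
  have hD0 : 0 ≤ D := (Finset.sum_nonneg fun j _ => sq_nonneg _).trans hD
  have hc : 0 ≤ c := (norm_nonneg B).trans hB
  have hcompare : ∑ j, B (e j) (e j) - ∑ j, B (e' j) (e' j)
      ≤ c * √(Module.finrank ℝ E * (2 * D)) := by
    refine (le_abs_self _).trans ((abs_sum_bilin_sub_le B e e' hcard).trans ?_)
    gcongr
  linarith [two_mul_mul_sqrt_le (Nat.cast_nonneg (Module.finrank ℝ E)) hD0 c]

theorem sum_inner_fderiv_fderiv_le {m : ℕ} (hm : Module.finrank ℝ X = m)
    (hM : IsGraphOver M g U) (hU : U ∈ 𝓝 x) (hg : ContDiffAt ℝ 2 g x) (y : Y)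
    (S : Gr m (WithLp 2 (X × Y))) {κ : Type*} [Fintype κ] (e : OrthonormalBasis κ ℝ S.1) :
    2 * ∑ j, ⟪y, fderiv ℝ (fderiv ℝ g) x (e j : WithLp 2 (X × Y)).fst (e j).1.fst⟫
      ≤ 2 * ((1 + ‖fderiv ℝ g x‖) * ‖y‖ * ‖meanCurvature M (graphMap g x)‖)
        + 2 * Module.finrank ℝ (WithLp 2 (X × Y)) * (‖y‖ * ‖fderiv ℝ (fderiv ℝ g) x‖) ^ 2
        + ∑ j, ‖(e j).1.snd - fderiv ℝ g x (e j).1.fst‖ ^ 2 := by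
  have hT := (eventually_tangentPlane_eq_graphPlane hM hU hg).self_of_nhds
  set T := tangentPlane M (graphMap g x)
  let e' := stdOrthonormalBasis ℝ T
  let B : WithLp 2 (X × Y) →L[ℝ] WithLp 2 (X × Y) →L[ℝ] ℝ :=
    (ContinuousLinearMap.compL ℝ X Y ℝ (innerSL ℝ y) ∘L fderiv ℝ (fderiv ℝ g) x).bilinearComp
      (WithLp.fstL 2 ℝ X Y) (WithLp.fstL 2 ℝ X Y)
  have hB (v w : WithLp 2 (X × Y)) :
      ‖B v w‖ ≤ ‖y‖ * ‖fderiv ℝ (fderiv ℝ g) x‖ * ‖v‖ * ‖w‖ :=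
    calc ‖B v w‖ ≤ ‖y‖ * (‖fderiv ℝ (fderiv ℝ g) x‖ * ‖v.fst‖ * ‖w.fst‖) :=
          (norm_inner_le_norm _ _).trans (by gcongr; exact ContinuousLinearMap.le_opNorm₂ _ _ _)
      _ ≤ ‖y‖ * (‖fderiv ℝ (fderiv ℝ g) x‖ * ‖v‖ * ‖w‖) := by
          gcongr
          exacts [WithLp.norm_fst_le _ v, WithLp.norm_fst_le _ w]
      _ = ‖y‖ * ‖fderiv ℝ (fderiv ℝ g) x‖ * ‖v‖ * ‖w‖ := by ring
  have hcard : Fintype.card κ = Fintype.card (Fin (Module.finrank ℝ T)) := by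
    rw [← Module.finrank_eq_card_basis e.toBasis, S.2, Fintype.card_fin, hT,
      finrank_graphPlane, hm]
  have htilt : ∑ j, ‖Tᗮ.starProjection (e j : WithLp 2 (X × Y))‖ ^ 2
      ≤ ∑ j, ‖(e j).1.snd - fderiv ℝ g x (e j).1.fst‖ ^ 2 := by
    refine Finset.sum_le_sum fun j _ => ?_
    rw [hT]
    gcongr
    exact norm_starProjection_graphPlane_orthogonal_le _ _
  have hcurvature : ∑ i, B (e' i) (e' i)
      ≤ (1 + ‖fderiv ℝ g x‖) * ‖y‖ * ‖meanCurvature M (graphMap g x)‖ := by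
    refine (inner_sum _ _ y).symm.trans_le ((real_inner_le_norm _ _).trans ?_)
    rw [mul_comm _ ‖y‖, mul_assoc]
    gcongr
    exact norm_sum_fderiv_fderiv_le_meanCurvature hM hU hg
  refine (two_mul_sum_bilin_le e e' hcard
    (B.opNorm_le_bound₂ (by positivity) hB) htilt).trans ?_
  gcongr

end Curvature

section Height

section

variable {X Y : Type*} [NormedAddCommGroup X] [NormedAddCommGroup Y]

/-- The squared vertical distance from the graph of `g`. -/
def heightSq (g : X → Y) (z : WithLp 2 (X × Y)) : ℝ := ‖z.snd - g z.fst‖ ^ 2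

/-- A perturbation of the squared height which is subharmonic along every `m`-plane when the graph
of `g` is flat and its mean curvature is bounded by `k`. -/
def barrier (g : X → Y) (p : WithLp 2 (X × Y)) (k : ℝ) (z : WithLp 2 (X × Y)) : ℝ :=
  heightSq g z + 1 / 16 * (‖z - p‖ ^ 2 * heightSq g z) + 85 * k ^ 2 * ‖z - p‖ ^ 2

theorem barrier_nonneg (g : X → Y) (p : WithLp 2 (X × Y)) (k : ℝ) (z : WithLp 2 (X × Y)) :
    0 ≤ barrier g p k z := by
  unfold barrier heightSq
  positivity

end

variable {X Y : Type*} [NormedAddCommGroup X] [InnerProductSpace ℝ X]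
  [NormedAddCommGroup Y] [InnerProductSpace ℝ Y] {M : Set (WithLp 2 (X × Y))} {g : X → Y}
  {U : Set X} {z : WithLp 2 (X × Y)}

theorem hasFDerivAt_snd_sub (hg : DifferentiableAt ℝ g z.fst) :
    HasFDerivAt (fun z : WithLp 2 (X × Y) => z.snd - g z.fst)
      (WithLp.sndL 2 ℝ X Y - fderiv ℝ g z.fst ∘L WithLp.fstL 2 ℝ X Y) z :=
  (WithLp.sndL 2 ℝ X Y).hasFDerivAt.sub
    (hg.hasFDerivAt.comp (f := WithLp.fst) z (WithLp.fstL 2 ℝ X Y).hasFDerivAt)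

theorem contDiffAt_snd_sub {k : WithTop ℕ∞} (hg : ContDiffAt ℝ k g z.fst) :
    ContDiffAt ℝ k (fun z : WithLp 2 (X × Y) => z.snd - g z.fst) z :=
  (WithLp.sndL 2 ℝ X Y).contDiff.contDiffAt.sub
    (hg.comp (f := WithLp.fst) z (WithLp.fstL 2 ℝ X Y).contDiff.contDiffAt)

theorem fderiv_fderiv_snd_sub (hg : ContDiffAt ℝ 2 g z.fst) (v w : WithLp 2 (X × Y)) :
    fderiv ℝ (fderiv ℝ fun z : WithLp 2 (X × Y) => z.snd - g z.fst) z v w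
      = -fderiv ℝ (fderiv ℝ g) z.fst v.fst w.fst := by
  have hDg : HasFDerivAt (fderiv ℝ g) (fderiv ℝ (fderiv ℝ g) z.fst) z.fst :=
    ((hg.fderiv_right one_add_one_eq_two.le).differentiableAt one_ne_zero).hasFDerivAt
  have hderiv : fderiv ℝ (fun z : WithLp 2 (X × Y) => z.snd - g z.fst) =ᶠ[𝓝 z]
      fun z => WithLp.sndL 2 ℝ X Y - fderiv ℝ g z.fst ∘L WithLp.fstL 2 ℝ X Y := by
    filter_upwards [preimage_fst_mem_nhds (hg.eventually (by simp))] with y hy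
    exact (hasFDerivAt_snd_sub (ContDiffAt.differentiableAt hy two_ne_zero)).fderiv
  have hDg' : HasFDerivAt (fun y : WithLp 2 (X × Y) => fderiv ℝ g y.fst)
      (fderiv ℝ (fderiv ℝ g) z.fst ∘L WithLp.fstL 2 ℝ X Y) z :=
    hDg.comp (f := WithLp.fst) z (WithLp.fstL 2 ℝ X Y).hasFDerivAt
  rw [hderiv.fderiv_eq,
    ((hDg'.clm_comp (hasFDerivAt_const (WithLp.fstL 2 ℝ X Y) z)).const_sub _).fderiv]
  simp

theorem contDiffAt_heightSq {k : WithTop ℕ∞} (hg : ContDiffAt ℝ k g z.fst) :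
    ContDiffAt ℝ k (heightSq g) z :=
  (contDiffAt_snd_sub hg).norm_sq ℝ

theorem fderiv_heightSq (hg : DifferentiableAt ℝ g z.fst) (v : WithLp 2 (X × Y)) :
    fderiv ℝ (heightSq g) z v
      = 2 * ⟪z.snd - g z.fst, v.snd - fderiv ℝ g z.fst v.fst⟫ := by
  have h : HasFDerivAt (heightSq g) _ z := (hasFDerivAt_snd_sub hg).norm_sq
  rw [h.fderiv, _root_.smul_apply, nsmul_eq_mul]
  rfl

theorem contDiffAt_barrier {l : WithTop ℕ∞} (p : WithLp 2 (X × Y)) (k : ℝ)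
    (hg : ContDiffAt ℝ l g z.fst) : ContDiffAt ℝ l (barrier g p k) z := by
  have hh := contDiffAt_heightSq hg
  have hp : ContDiffAt ℝ l (fun z => ‖z - p‖ ^ 2) z := (contDiff_norm_sub_sq p).contDiffAt
  exact (hh.add (contDiffAt_const.mul (hp.mul hh))).add (contDiffAt_const.mul hp)

variable [FiniteDimensional ℝ X] [FiniteDimensional ℝ Y] {m : ℕ} {κ : Type*} [Fintype κ]
  {S : Gr m (WithLp 2 (X × Y))} {k : ℝ}

theorem abs_fderiv_heightSq_proj_le (hg : DifferentiableAt ℝ g z.fst)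
    (e : OrthonormalBasis κ ℝ S.1) (v : WithLp 2 (X × Y)) :
    |fderiv ℝ (heightSq g) z (S.proj v)| ≤ 2 * (‖z.snd - g z.fst‖ *
      (√(∑ j, ‖(e j : WithLp 2 (X × Y)).snd - fderiv ℝ g z.fst (e j).1.fst‖ ^ 2) * ‖v‖)) := by
  rw [fderiv_heightSq hg, abs_mul, abs_two]
  gcongr
  refine (abs_real_inner_le_norm _ _).trans ?_
  gcongr
  rw [← sq_le_sq₀ (norm_nonneg _) (by positivity), mul_pow,
    Real.sq_sqrt (Finset.sum_nonneg fun j _ => sq_nonneg _)]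
  exact norm_sq_map_starProjection_le
    (WithLp.sndL 2 ℝ X Y - fderiv ℝ g z.fst ∘L WithLp.fstL 2 ℝ X Y) e v

theorem le_laplacianAlong_heightSq (hm : Module.finrank ℝ X = m) (hM : IsGraphOver M g U)
    (hU : U ∈ 𝓝 z.fst) (hg : ContDiffAt ℝ 2 g z.fst) (hDg : ‖fderiv ℝ g z.fst‖ ≤ 1)
    (hD2g : Module.finrank ℝ (WithLp 2 (X × Y)) * ‖fderiv ℝ (fderiv ℝ g) z.fst‖ ^ 2 ≤ 1 / 160)
    (hk : ‖meanCurvature M (graphMap g z.fst)‖ ≤ k) (e : OrthonormalBasis κ ℝ S.1) :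
    ∑ j, ‖(e j : WithLp 2 (X × Y)).snd - fderiv ℝ g z.fst (e j).1.fst‖ ^ 2
        - 3 / 80 * heightSq g z - 160 * k ^ 2
      ≤ laplacianAlong S (heightSq g) z := by
  have hlaplacian := laplacianAlong_norm_sq S e (contDiffAt_snd_sub hg)
  simp_rw [(hasFDerivAt_snd_sub (hg.differentiableAt two_ne_zero)).fderiv,
    fderiv_fderiv_snd_sub hg, inner_neg_right, Finset.sum_add_distrib, Finset.sum_neg_distrib]
    at hlaplacian
  have hhessian := sum_inner_fderiv_fderiv_le hm hM hU hg (z.snd - g z.fst) S e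
  set F := ‖z.snd - g z.fst‖
  set D := ∑ j, ‖(e j).1.snd - fderiv ℝ g z.fst (e j).1.fst‖ ^ 2
  have hcurvature : (1 + ‖fderiv ℝ g z.fst‖) * F * ‖meanCurvature M (graphMap g z.fst)‖
      ≤ (1 + 1) * F * k := by gcongr
  have hYoung : 4 * (F * k) ≤ F ^ 2 / 40 + 160 * k ^ 2 := by
    linarith [sq_nonneg (F - 80 * k)]
  have hD2gF := mul_le_mul_of_nonneg_right hD2g (sq_nonneg F)
  change _ = 2 * (D + _) at hlaplacian
  change _ - _ * F ^ 2 - _ ≤ laplacianAlong S (fun z => ‖z.snd - g z.fst‖ ^ 2) z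
  linarith

theorem laplacianAlong_barrier (S : Gr m (WithLp 2 (X × Y))) (hg : ContDiffAt ℝ 2 g z.fst)
    (p : WithLp 2 (X × Y)) (k : ℝ) :
    laplacianAlong S (barrier g p k) z
      = (1 + ‖z - p‖ ^ 2 / 16) * laplacianAlong S (heightSq g) z
        + (heightSq g z / 8 + 170 * k ^ 2) * m
        + 1 / 4 * fderiv ℝ (heightSq g) z (S.proj (z - p)) := by
  have hh := contDiffAt_heightSq hg
  have hp : ContDiffAt ℝ 2 (fun z => ‖z - p‖ ^ 2) z := (contDiff_norm_sub_sq p).contDiffAt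
  unfold barrier
  rw [laplacianAlong_add S (hh.add (contDiffAt_const.mul (hp.mul hh))) (contDiffAt_const.mul hp),
    laplacianAlong_add S hh (contDiffAt_const.mul (hp.mul hh)),
    laplacianAlong_const_mul S _ (hp.mul hh), laplacianAlong_const_mul S _ hp,
    laplacianAlong_mul S hp hh, laplacianAlong_norm_sub_sq, gradient_norm_sub_sq, map_smul,
    real_inner_smul_left, real_inner_comm, inner_gradient_left]
  ring

theorem barrier_estimate {t D F k L c a : ℝ} (ht0 : 0 ≤ t) (ht1 : t ≤ 1) (hD : 0 ≤ D)
    (hL : D - 3 / 80 * F ^ 2 - 160 * k ^ 2 ≤ L) (hc : |c| ≤ 2 * (F * √D)) (ha : 1 ≤ a) :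
    0 ≤ (1 + t / 16) * L + (F ^ 2 / 8 + 170 * k ^ 2) * a + 1 / 4 * c := by
  have hYoung : F * √D / 2 ≤ D + F ^ 2 / 16 := by
    linarith [sq_nonneg (F / 4 - √D), Real.sq_sqrt hD]
  calc 0 ≤ D - 17 / 16 * (3 / 80 * F ^ 2 + 160 * k ^ 2)
          + (F ^ 2 / 8 + 170 * k ^ 2) * 1 - F * √D / 2 := by
        linarith [sq_nonneg F]
    _ ≤ (1 + t / 16) * (D - 3 / 80 * F ^ 2 - 160 * k ^ 2)
          + (F ^ 2 / 8 + 170 * k ^ 2) * 1 - F * √D / 2 := by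
        have htD : 0 ≤ t * D := mul_nonneg ht0 hD
        have htF : t * (3 / 80 * F ^ 2 + 160 * k ^ 2) ≤ 1 * (3 / 80 * F ^ 2 + 160 * k ^ 2) := by
          gcongr
        linarith
    _ ≤ (1 + t / 16) * L + (F ^ 2 / 8 + 170 * k ^ 2) * a - F * √D / 2 := by gcongr
    _ ≤ (1 + t / 16) * L + (F ^ 2 / 8 + 170 * k ^ 2) * a + 1 / 4 * c := by
        linarith [neg_le_of_abs_le hc]

theorem laplacianAlong_barrier_nonneg (hm : Module.finrank ℝ X = m) (hm1 : 1 ≤ m)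
    (hM : IsGraphOver M g U) (hU : U ∈ 𝓝 z.fst) (hg : ContDiffAt ℝ 2 g z.fst)
    (hDg : ‖fderiv ℝ g z.fst‖ ≤ 1)
    (hD2g : Module.finrank ℝ (WithLp 2 (X × Y)) * ‖fderiv ℝ (fderiv ℝ g) z.fst‖ ^ 2 ≤ 1 / 160)
    (hk : ‖meanCurvature M (graphMap g z.fst)‖ ≤ k) {p : WithLp 2 (X × Y)} (hp : ‖z - p‖ ≤ 1)
    (S : Gr m (WithLp 2 (X × Y))) : 0 ≤ laplacianAlong S (barrier g p k) z := by
  set e := stdOrthonormalBasis ℝ S.1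
  rw [laplacianAlong_barrier S hg p k]
  refine barrier_estimate (sq_nonneg _) (pow_le_one₀ (norm_nonneg _) hp)
    (Finset.sum_nonneg fun j _ => sq_nonneg _)
    (le_laplacianAlong_heightSq hm hM hU hg hDg hD2g hk e) ?_ (Nat.one_le_cast.2 hm1)
  refine (abs_fderiv_heightSq_proj_le (hg.differentiableAt two_ne_zero) e _).trans ?_
  gcongr
  exact mul_le_of_le_one_right (Real.sqrt_nonneg _) hp

end Height

section HeightEstimate

section

variable {X Y : Type*} [NormedAddCommGroup X] [NormedAddCommGroup Y] {M : Set (WithLp 2 (X × Y))}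
  {g : X → Y} {U : Set X} {z p : WithLp 2 (X × Y)}

theorem infEDist_sq_le_heightSq (hM : IsGraphOver M g U) (hz : z.fst ∈ U) :
    Metric.infEDist z M ^ 2 ≤ ENNReal.ofReal (heightSq g z) := by
  have hvert : z - graphMap g z.fst = WithLp.toLp 2 (0, z.snd - g z.fst) :=
    ext_fst_snd (sub_self z.fst) rfl
  have hdist : edist z (graphMap g z.fst) = ENNReal.ofReal ‖z.snd - g z.fst‖ := by
    rw [edist_dist, dist_eq_norm, hvert, WithLp.norm_toLp_snd]
  rw [heightSq, ENNReal.ofReal_pow (norm_nonneg _), ← hdist]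
  gcongr
  exact Metric.infEDist_le_edist_of_mem (hM.graphMap_mem hz)

theorem IsGraphOver.norm_snd_sub_le (hM : IsGraphOver M g (Metric.ball 0 2))
    (hg : LipschitzOnWith 1 g (Metric.ball 0 2)) (hgz : ‖g z.fst‖ ≤ 1) (hz1 : ‖z.fst‖ < 1)
    (hz2 : ‖z.snd‖ < 1) (hp : p ∈ M) : ‖z.snd - g z.fst‖ ≤ 2 * ‖z - p‖ := by
  have hfst : ‖z.fst - p.fst‖ ≤ ‖z - p‖ := WithLp.norm_fst_le _ (z - p)
  have hsnd : ‖z.snd - p.snd‖ ≤ ‖z - p‖ := WithLp.norm_snd_le _ (z - p)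
  have hz : z.fst ∈ Metric.ball 0 2 := mem_ball_zero_iff.2 (by linarith)
  by_cases hp2 : p.fst ∈ Metric.ball 0 2
  · have hpg : p.snd = g p.fst := congrArg WithLp.snd (hM.eq_graphMap hp hp2)
    have hlip : ‖g p.fst - g z.fst‖ ≤ ‖z.fst - p.fst‖ := by
      simpa [norm_sub_rev z.fst] using hg.norm_sub_le hp2 hz
    calc ‖z.snd - g z.fst‖ ≤ ‖z.snd - p.snd‖ + ‖g p.fst - g z.fst‖ :=
          hpg ▸ norm_sub_le_norm_sub_add_norm_sub _ _ _
      _ ≤ 2 * ‖z - p‖ := by linarith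
  · have hp2' : 2 ≤ ‖p.fst‖ := not_lt.1 (mt mem_ball_zero_iff.2 hp2)
    have hfar : ‖p.fst‖ - ‖z.fst‖ ≤ ‖z.fst - p.fst‖ :=
      norm_sub_rev z.fst p.fst ▸ norm_sub_norm_le _ _
    linarith [norm_sub_le z.snd (g z.fst)]

theorem IsGraphOver.heightSq_le_infEDist_sq (hM : IsGraphOver M g (Metric.ball 0 2))
    (hg : LipschitzOnWith 1 g (Metric.ball 0 2)) (hgz : ‖g z.fst‖ ≤ 1) (hz1 : ‖z.fst‖ < 1)
    (hz2 : ‖z.snd‖ < 1) : ENNReal.ofReal (heightSq g z) ≤ 4 * Metric.infEDist z M ^ 2 := by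
  have hle : ENNReal.ofReal ‖z.snd - g z.fst‖ ≤ 2 * Metric.infEDist z M := by
    rw [mul_comm, ← ENNReal.div_le_iff_le_mul (.inl two_ne_zero) (.inl ENNReal.ofNat_ne_top)]
    refine Metric.le_infEDist.2 fun p hp => ENNReal.div_le_of_le_mul' ?_
    calc ENNReal.ofReal ‖z.snd - g z.fst‖ ≤ ENNReal.ofReal (2 * ‖z - p‖) :=
          ENNReal.ofReal_le_ofReal (hM.norm_snd_sub_le hg hgz hz1 hz2 hp)
      _ = 2 * edist z p := by
        rw [edist_dist, dist_eq_norm, ENNReal.ofReal_mul zero_le_two, ENNReal.ofReal_ofNat]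
  calc ENNReal.ofReal (heightSq g z) = ENNReal.ofReal ‖z.snd - g z.fst‖ ^ 2 :=
        ENNReal.ofReal_pow (norm_nonneg _) 2
    _ ≤ (2 * Metric.infEDist z M) ^ 2 := by gcongr
    _ = 4 * Metric.infEDist z M ^ 2 := by ring

theorem barrier_self (g : X → Y) (p : WithLp 2 (X × Y)) (k : ℝ) :
    barrier g p k p = heightSq g p := by
  simp [barrier]

theorem barrier_le (g : X → Y) (k : ℝ) (hzp : ‖z - p‖ ≤ 1) :
    barrier g p k z ≤ 2 * heightSq g z + 85 * k ^ 2 := by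
  have hsq : ‖z - p‖ ^ 2 ≤ 1 := pow_le_one₀ (norm_nonneg _) hzp
  have hheight : ‖z - p‖ ^ 2 * heightSq g z ≤ heightSq g z :=
    mul_le_of_le_one_left (sq_nonneg _) hsq
  have hk : 85 * k ^ 2 * ‖z - p‖ ^ 2 ≤ 85 * k ^ 2 := mul_le_of_le_one_right (by positivity) hsq
  have hnn : 0 ≤ heightSq g z := sq_nonneg _
  unfold barrier
  linarith

theorem setLIntegral_heightSq_le [MeasurableSpace (WithLp 2 (X × Y))]
    {μ : Measure (WithLp 2 (X × Y))} {W : Set (WithLp 2 (X × Y))} (hW : MeasurableSet W) {k : ℝ}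
    {H : ℝ≥0∞} (hk : ENNReal.ofReal (k ^ 2) ≤ H)
    (hM : ∀ᵐ z ∂μ, z ∈ W → ENNReal.ofReal (heightSq g z) ≤ 4 * Metric.infEDist z M ^ 2) :
    ∫⁻ z in W, ENNReal.ofReal (2 * heightSq g z + 85 * k ^ 2) ∂μ
      ≤ 85 * (∫⁻ z in W, Metric.infEDist z M ^ 2 ∂μ + μ W * H) := by
  have hle : ∀ᵐ z ∂μ.restrict W, ENNReal.ofReal (2 * heightSq g z + 85 * k ^ 2)
      ≤ 85 * (Metric.infEDist z M ^ 2 + H) := by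
    filter_upwards [(ae_restrict_iff' hW).2 hM] with z hz
    have hnn : 0 ≤ heightSq g z := sq_nonneg _
    rw [ENNReal.ofReal_add (by positivity) (by positivity), ENNReal.ofReal_mul zero_le_two,
      ENNReal.ofReal_mul (by norm_num), ENNReal.ofReal_ofNat, ENNReal.ofReal_ofNat, mul_add]
    refine add_le_add ?_ (mul_le_mul_right hk 85)
    calc 2 * ENNReal.ofReal (heightSq g z) ≤ 2 * (4 * Metric.infEDist z M ^ 2) := by gcongr
      _ = 8 * Metric.infEDist z M ^ 2 := by ring
      _ ≤ 85 * Metric.infEDist z M ^ 2 := by gcongr; norm_num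
  calc ∫⁻ z in W, ENNReal.ofReal (2 * heightSq g z + 85 * k ^ 2) ∂μ
      ≤ ∫⁻ z in W, 85 * (Metric.infEDist z M ^ 2 + H) ∂μ := lintegral_mono_ae hle
    _ = 85 * (∫⁻ z in W, Metric.infEDist z M ^ 2 ∂μ + μ W * H) := by
      rw [lintegral_const_mul' _ _ ENNReal.ofNat_ne_top, lintegral_add_right _ measurable_const,
        setLIntegral_const, mul_comm H]

end

theorem le_of_ae_le_of_mem_support {E β : Type*} [TopologicalSpace E] [MeasurableSpace E]
    {μ : Measure E} [TopologicalSpace β] [LinearOrder β] [ClosedIicTopology β] {f : E → β} {x : E}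
    {W : Set E} {b : β} (hx : x ∈ μ.support) (hf : ContinuousAt f x) (hW : W ∈ 𝓝 x)
    (hle : ∀ᵐ y ∂μ, y ∈ W → f y ≤ b) : f x ≤ b := by
  by_contra! hlt
  have hpos := (Measure.mem_support_iff_forall x).1 hx _
    (inter_mem hW (hf.eventually (isOpen_Ioi.mem_nhds hlt)))
  refine hpos.ne' (measure_mono_null ?_ (ae_iff.1 hle))
  exact fun y hy hle => (hle hy.1).not_gt hy.2

/-- A `C^∞` map on `U` which is bounded by `1`, has Lipschitz constant at most `1` and whose second
derivative is small enough for `barrier` to be subharmonic along every plane. -/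
structure IsAlmostFlatOn {X Y : Type*} [NormedAddCommGroup X] [NormedSpace ℝ X]
    [NormedAddCommGroup Y] [NormedSpace ℝ Y] (g : X → Y) (U : Set X) : Prop where
  contDiffAt : ∀ x ∈ U, ContDiffAt ℝ ∞ g x
  norm_le_one : ∀ x ∈ U, ‖g x‖ ≤ 1
  norm_fderiv_le_one : ∀ x ∈ U, ‖fderiv ℝ g x‖ ≤ 1
  norm_fderiv_fderiv_sq_le : ∀ x ∈ U,
    Module.finrank ℝ (WithLp 2 (X × Y)) * ‖fderiv ℝ (fderiv ℝ g) x‖ ^ 2 ≤ 1 / 160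

theorem IsAlmostFlatOn.mono {X Y : Type*} [NormedAddCommGroup X] [NormedSpace ℝ X]
    [NormedAddCommGroup Y] [NormedSpace ℝ Y] {g : X → Y} {U W : Set X} (hg : IsAlmostFlatOn g U)
    (hW : W ⊆ U) : IsAlmostFlatOn g W :=
  ⟨fun x hx => hg.1 x (hW hx), fun x hx => hg.2 x (hW hx), fun x hx => hg.3 x (hW hx),
    fun x hx => hg.4 x (hW hx)⟩

theorem IsAlmostFlatOn.lipschitzOnWith {X Y : Type*} [NormedAddCommGroup X] [NormedSpace ℝ X]
    [NormedAddCommGroup Y] [NormedSpace ℝ Y] {g : X → Y} {U : Set X} (hg : IsAlmostFlatOn g U)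
    (hU : Convex ℝ U) : LipschitzOnWith 1 g U :=
  hU.lipschitzOnWith_of_nnnorm_fderiv_le
    (fun x hx => (hg.contDiffAt x hx).differentiableAt (by simp)) hg.norm_fderiv_le_one

section

variable {X Y : Type*} [NormedAddCommGroup X] [InnerProductSpace ℝ X] [FiniteDimensional ℝ X]
  [NormedAddCommGroup Y] [InnerProductSpace ℝ Y] [FiniteDimensional ℝ Y]
  [MeasurableSpace (WithLp 2 (X × Y))] [BorelSpace (WithLp 2 (X × Y))] {m : ℕ} {ρ : ℝ}

theorem exists_heightSq_mul_le (hX : Module.finrank ℝ X = m) (hm : 1 ≤ m) (hρ : 0 < ρ)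
    (hρ1 : ρ ≤ 1) :
    ∃ K : ℝ≥0, 0 < K ∧ ∀ {M : Set (WithLp 2 (X × Y))} {g : X → Y} {U : Set X} {k : ℝ}
      {V : Measure (WithLp 2 (X × Y) × Gr m (WithLp 2 (X × Y)))} {θ : ℝ≥0}
      {p : WithLp 2 (X × Y)}, IsOpen U → IsGraphOver M g U → IsAlmostFlatOn g U →
      (∀ x ∈ U, ‖meanCurvature M (graphMap g x)‖ ≤ k) →
      IsVarifold (WithLp.fst ⁻¹' U) V → IsStationary (WithLp.fst ⁻¹' U) V →
      Metric.closedBall p ρ ⊆ WithLp.fst ⁻¹' U → HasLowerDensity (weight V) m θ p →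
      ENNReal.ofReal (heightSq g p) * θ ≤ K * ∫⁻ z in Metric.closedBall p ρ,
        ENNReal.ofReal (2 * heightSq g z + 85 * k ^ 2) ∂weight V := by
  obtain ⟨K, hK, hmean⟩ := exists_setLIntegral_closedBall_le (WithLp 2 (X × Y)) hm hρ
  refine ⟨K, hK, ?_⟩
  intro M g U k V θ p hU hM hg hk hV hstat hpU hp
  have hnorm : ∀ z ∈ Metric.closedBall p ρ, ‖z - p‖ ≤ 1 := fun z hz =>
    (mem_closedBall_iff_norm.1 hz).trans hρ1
  have hsmooth : ∀ z ∈ WithLp.fst ⁻¹' U, ContDiffAt ℝ ∞ (barrier g p k) z := fun z hz =>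
    contDiffAt_barrier p k (hg.contDiffAt z.fst hz)
  have hsub : ∀ z ∈ Metric.closedBall p ρ, ∀ S : Gr m _,
      0 ≤ laplacianAlong S (barrier g p k) z := fun z hz =>
    have hzU : z.fst ∈ U := hpU hz
    laplacianAlong_barrier_nonneg hX hm hM (hU.mem_nhds hzU)
      (contDiffAt_infty.1 (hg.contDiffAt _ hzU) 2) (hg.norm_fderiv_le_one _ hzU)
      (hg.norm_fderiv_fderiv_sq_le _ hzU) (hk _ hzU) (hnorm z hz)
  have hball : ∀ᶠ σ in 𝓝[>] (0 : ℝ),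
      ∫⁻ z in Metric.closedBall p σ, ENNReal.ofReal (barrier g p k z) ∂weight V ≤
        (K * ∫⁻ z in Metric.closedBall p ρ, ENNReal.ofReal (barrier g p k z) ∂weight V) *
          ENNReal.ofReal σ ^ m := by
    filter_upwards [Ioo_mem_nhdsGT (half_pos hρ)] with σ hσ
    rw [mul_right_comm]
    exact hmean (hU.preimage (WithLp.fstL 2 ℝ X Y).continuous) hV hstat hpU
      (fun z hz => (hsmooth z hz).contDiffWithinAt) (fun z _ => barrier_nonneg g p k z) hsub σ
      hσ.1 (by nlinarith [hσ.1, hσ.2])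
  rw [← barrier_self g p k]
  refine (hp.mul_le (f := fun z => ENNReal.ofReal (barrier g p k z))
    (ENNReal.continuous_ofReal.continuousAt.comp
      (hsmooth p (hpU (Metric.mem_closedBall_self hρ.le))).continuousAt) hball).trans ?_
  refine mul_le_mul_right ?_ _
  exact setLIntegral_mono' Metric.isClosed_closedBall.measurableSet fun z hz =>
    ENNReal.ofReal_le_ofReal (barrier_le g k (hnorm z hz))

end

section

variable {m n : ℕ} {M : Set (Space m n)}

theorem cyl_eq_preimage (m n : ℕ) (r : ℝ) : cyl m n r = WithLp.fst ⁻¹' Metric.ball 0 r :=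
  Set.ext fun _ => mem_ball_zero_iff.symm

theorem isOpen_cyl (m n : ℕ) (r : ℝ) : IsOpen (cyl m n r) :=
  isOpen_lt (WithLp.fstL 2 ℝ _ _).continuous.norm continuous_const

theorem closedBall_subset_cyl {r ρ : ℝ} {p : Space m n} (hp : p ∈ cyl m n r) :
    Metric.closedBall p ρ ⊆ cyl m n (r + ρ) := fun z hz =>
  calc ‖z.fst‖ ≤ ‖p.fst‖ + ‖z.fst - p.fst‖ := norm_le_norm_add_norm_sub' _ _
    _ < r + ρ := add_lt_add_of_lt_of_le hp
      ((WithLp.norm_fst_le _ (z - p)).trans (mem_closedBall_iff_norm.1 hz))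

theorem IsSmoothSubmanifold.exists_isAlmostFlatOn (hM : IsSmoothSubmanifold M) {δ : ℝ}
    (hflat : IsFlat M 2 δ) (hδ : δ ≤ 1 / (7 * (Module.finrank ℝ (Space m n) + 1))) :
    ∃ g, IsGraphOver M g (Metric.ball 0 2) ∧ IsAlmostFlatOn g (Metric.ball 0 2) := by
  obtain ⟨g, hg, hMg, hgδ⟩ := hflat
  set N : ℝ := (Module.finrank ℝ (Space m n) : ℝ)
  have hN : 0 ≤ N := Nat.cast_nonneg _
  have hNδ : 7 * δ * (N + 1) ≤ 1 := by
    rw [le_div_iff₀ (by positivity)] at hδ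
    linarith
  have hgraph : IsGraphOver M g (Metric.ball 0 2) := fun z hz => by
    have hz' := Set.ext_iff.1 hMg z
    rwa [cyl_eq_preimage, mem_inter_iff, mem_ofPred_eq, and_iff_left (mem_preimage.2 hz),
      and_iff_right hz] at hz'
  have hbound (x) (hx : x ∈ Metric.ball 0 2) :
      0 ≤ δ ∧ ‖g x‖ ≤ 2 * δ ∧ ‖fderiv ℝ g x‖ ≤ δ ∧ 2 * ‖fderiv ℝ (fderiv ℝ g) x‖ ≤ δ := by
    have h0 := norm_nonneg (g x)
    have h1 := norm_nonneg (fderiv ℝ g x)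
    have h2 := norm_nonneg (fderiv ℝ (fderiv ℝ g) x)
    have := hgδ x hx
    refine ⟨?_, ?_, ?_, ?_⟩ <;> linarith
  have hδ7 (h0 : 0 ≤ δ) : 7 * δ ≤ 1 := by nlinarith
  refine ⟨g, hgraph, fun x hx => ?_, fun x hx => ?_, fun x hx => ?_, fun x hx => ?_⟩
  · exact hM.contDiffAt hgraph (Metric.isOpen_ball.mem_nhds hx)
      ((hg.contDiffAt (Metric.isOpen_ball.mem_nhds hx)).differentiableAt two_ne_zero)
  · obtain ⟨h0, h, -, -⟩ := hbound x hx
    linarith [hδ7 h0]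
  · obtain ⟨h0, -, h, -⟩ := hbound x hx
    linarith [hδ7 h0]
  · obtain ⟨h0, -, -, h⟩ := hbound x hx
    calc N * ‖fderiv ℝ (fderiv ℝ g) x‖ ^ 2 ≤ N * (δ / 2) ^ 2 := by gcongr; linarith
      _ ≤ 1 / 160 := by nlinarith [mul_nonneg hN h0, hδ7 h0]

end

theorem norm_le_sqrt_toReal {F : Type*} [SeminormedAddCommGroup F] {x : F} {H : ℝ≥0∞}
    (hH : H ≠ ⊤) (hx : ‖x‖ₑ ^ 2 ≤ H) : ‖x‖ ≤ √H.toReal :=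
  Real.le_sqrt_of_sq_le (by simpa using ENNReal.toReal_mono hH hx)

theorem exists_heightSq_mul_le_lintegral_infEDist_sq (m n : ℕ) (hm : 1 ≤ m) :
    ∃ K : ℝ≥0, 0 < K ∧ ∀ {M : Set (Space m n)} {V : Measure (Space m n × Gr m (Space m n))}
      {g : EuclideanSpace ℝ (Fin m) → EuclideanSpace ℝ (Fin n)} {H : ℝ≥0∞} {θ : ℝ≥0}
      {p : Space m n}, IsGraphOver M g (Metric.ball 0 2) → IsAlmostFlatOn g (Metric.ball 0 2) →
      H ≠ ⊤ → (∀ q ∈ M ∩ cyl m n 1, ‖meanCurvature M q‖ₑ ^ 2 ≤ H) →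
      IsVarifold (cyl m n 1) V → IsStationary (cyl m n 1) V →
      vsupp (cyl m n 1) V ⊆ {z | ‖z.fst‖ < 1 ∧ ‖z.snd‖ < 1} →
      p ∈ cyl m n (1 / 2) → HasLowerDensity (weight V) m θ p →
      ENNReal.ofReal (heightSq g p) * θ ≤
        K * ((∫⁻ z in cyl m n 1, Metric.infEDist z M ^ 2 ∂weight V) +
          weight V (cyl m n 1) * H) := by
  obtain ⟨K, hK, hpoint⟩ := exists_heightSq_mul_le (Y := EuclideanSpace ℝ (Fin n))
    (finrank_euclideanSpace_fin (𝕜 := ℝ)) hm (ρ := 1 / 2) (by norm_num) (by norm_num)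
  refine ⟨K * 85, by positivity, ?_⟩
  intro M V g H θ p hM hg hH hMH hV hstat hsupp hp hdens
  have hball : Metric.ball (0 : EuclideanSpace ℝ (Fin m)) 1 ⊆ Metric.ball 0 2 :=
    Metric.ball_subset_ball one_le_two
  have hpU : Metric.closedBall p (1 / 2) ⊆ cyl m n 1 := by
    simpa only [add_halves] using closedBall_subset_cyl (ρ := 1 / 2) hp
  have hcurv (x) (hx : x ∈ Metric.ball 0 1) : ‖meanCurvature M (graphMap g x)‖ ≤ √H.toReal :=
    norm_le_sqrt_toReal hH (hMH _ ⟨hM.graphMap_mem (hball hx), mem_ball_zero_iff.1 hx⟩)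
  have hheight : ∀ᵐ z ∂weight V, z ∈ cyl m n 1 →
      ENNReal.ofReal (heightSq g z) ≤ 4 * Metric.infEDist z M ^ 2 := by
    filter_upwards [Measure.support_mem_ae] with z hz hz1
    exact hM.heightSq_le_infEDist_sq (hg.lipschitzOnWith (convex_ball 0 2))
      (hg.norm_le_one _ (hball (mem_ball_zero_iff.2 hz1))) hz1 (hsupp ⟨hz, hz1⟩).2
  have hsqrt : ENNReal.ofReal (√H.toReal ^ 2) ≤ H := by
    rw [Real.sq_sqrt ENNReal.toReal_nonneg, ENNReal.ofReal_toReal hH]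
  rw [ENNReal.coe_mul, mul_assoc]
  refine (hpoint Metric.isOpen_ball (fun z hz => hM (hball hz)) (hg.mono hball) hcurv
    (cyl_eq_preimage m n 1 ▸ hV) (cyl_eq_preimage m n 1 ▸ hstat)
    (cyl_eq_preimage m n 1 ▸ hpU) hdens).trans (mul_le_mul_right ?_ _)
  exact (lintegral_mono_set hpU).trans
    (setLIntegral_heightSq_le (isOpen_cyl m n 1).measurableSet hsqrt hheight)

end HeightEstimate

end HeightBound

end

open HeightBound in
theorem proposition2p7_general (m n : ℕ) (hm : 1 ≤ m) {θ : ℝ≥0} (hθ : 0 < θ) :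
    ∃ (C : ℝ≥0) (δ₀ : ℝ), 0 < δ₀ ∧
      ∀ (δ : ℝ) (M : Set (Space m n)) (V : Measure (Space m n × Gr m (Space m n))),
        δ ≤ δ₀ →
        IsSmoothSubmanifold M →
        IsFlat M 2 δ →
        IsVarifold (cyl m n 1) V →
        (∀ᵐ z ∂weight V, HasLowerDensity (weight V) m θ z) →
        IsStationary (cyl m n 1) V →
        vsupp (cyl m n 1) V ⊆ {z | ‖z.fst‖ < 1 ∧ ‖z.snd‖ < 1} →
        (⨆ z ∈ vsupp (cyl m n 1) V ∩ cyl m n (1 / 2), Metric.infEDist z M ^ 2) ≤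
          C * ((∫⁻ z in cyl m n 1, Metric.infEDist z M ^ 2 ∂weight V) +
            weight V (cyl m n 1) * ⨆ p ∈ M ∩ cyl m n 1, ‖meanCurvature M p‖ₑ ^ 2) := by
  obtain ⟨K, hK, hpoint⟩ := exists_heightSq_mul_le_lintegral_infEDist_sq m n hm
  refine ⟨K / θ, 1 / (7 * (Module.finrank ℝ (Space m n) + 1)), by positivity, ?_⟩
  intro δ M V hδ hM hflat hV hdens hstat hsupp
  obtain ⟨g, hMg, hg⟩ := hM.exists_isAlmostFlatOn hflat hδ
  set H := ⨆ p ∈ M ∩ cyl m n 1, ‖meanCurvature M p‖ₑ ^ 2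
  refine iSup₂_le fun z ⟨⟨hz, hz1⟩, hz2⟩ => ?_
  have hμ : weight V (cyl m n 1) ≠ 0 :=
    ((Measure.mem_support_iff_forall z).1 hz _ ((isOpen_cyl m n 1).mem_nhds hz1)).ne'
  obtain hH | hH := eq_or_ne H ⊤
  · simp [hH, hμ, hK.ne', hθ.ne', ENNReal.mul_top]
  have hz3 : z.fst ∈ Metric.ball 0 2 := mem_ball_zero_iff.2 (hz1.trans one_lt_two)
  refine (infEDist_sq_le_heightSq hMg hz3).trans (le_of_ae_le_of_mem_support
    (f := fun z => ENNReal.ofReal (heightSq g z)) hz (ENNReal.continuous_ofReal.continuousAt.comp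
      (contDiffAt_heightSq (hg.contDiffAt _ hz3)).continuousAt)
    ((isOpen_cyl m n (1 / 2)).mem_nhds hz2) ?_)
  filter_upwards [hdens] with p hp hp2
  rw [ENNReal.coe_div hθ.ne', ← ENNReal.mul_div_right_comm,
    ENNReal.le_div_iff_mul_le (by simp [hθ.ne']) (by simp)]
  exact hpoint hMg hg hH (fun q hq => le_iSup₂ (f := fun q _ => ‖meanCurvature M q‖ₑ ^ 2) q hq)
    hV hstat hsupp hp2 hp

theorem proposition2p7 (m n : ℕ) (hm : 1 ≤ m) (hn : 1 ≤ n) :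
    ∃ (C : ℝ≥0) (δ₀ : ℝ), 0 < δ₀ ∧
      ∀ (δ : ℝ) (M : Set (HeightBound.Space m n))
        (V : Measure (HeightBound.Space m n × HeightBound.Gr m (HeightBound.Space m n))),
        δ ≤ δ₀ →
        HeightBound.IsSmoothSubmanifold M →
        HeightBound.IsFlat M 2 δ →
        HeightBound.IsIntegralVarifold (HeightBound.cyl m n 1) V →
        HeightBound.IsStationary (HeightBound.cyl m n 1) V →
        HeightBound.vsupp (HeightBound.cyl m n 1) V ⊆ {z | ‖z.fst‖ < 1 ∧ ‖z.snd‖ < 1} →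
        (⨆ z ∈ HeightBound.vsupp (HeightBound.cyl m n 1) V ∩ HeightBound.cyl m n (1 / 2),
            Metric.infEDist z M ^ 2) ≤
          C * ((∫⁻ z in HeightBound.cyl m n 1, Metric.infEDist z M ^ 2 ∂(HeightBound.weight V)) +
            HeightBound.weight V (HeightBound.cyl m n 1) *
              ⨆ p ∈ M ∩ HeightBound.cyl m n 1, ‖HeightBound.meanCurvature M p‖ₑ ^ 2) := by
  obtain ⟨C, δ₀, hδ₀, hC⟩ := proposition2p7_general m n hm
    (Real.toNNReal_pos.2 (half_pos (HeightBound.hatIntegral_pos m)))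
  exact ⟨C, δ₀, hδ₀, fun δ M V hδ hM hflat hV => hC δ M V hδ hM hflat hV.1 hV.ae_hasLowerDensity⟩
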